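/- **Conventions.** Fix a qudit dimension $q\ge 2$ (not necessarily prime). A ($q$-ary) quantum secret sharing (QSS) scheme for a secret of $m$ qudits and a finite set of parties is a quantum operation (completely positive trace-preserving map) that encodes $(\mathbb C^q)^{\otimes m}$ into shares $S_1,\dots,S_n$, where $S_j$ consists of $|S_j|$ qudits. A set $X$ of parties is *authorized* if some quantum operation acting on the shares in $X$ recovers every secret state, and *unauthorized* if the reduced state of the shares in $X$ does not depend on the secret state. * A $((k,n))$ quantum threshold (QTS) scheme, $1<k\le n\le 2k-1$: $n$ parties; every set of at least $k$ parties is authorized and every set of at most $k-1$ parties is unauthorized. * A $((t,n;z))$ ramp QSS scheme, $1\le z<t\le n\le t+z$: $n$ parties; every set of at least $t$ parties is authorized and every set of at most $z$ parties is unauthorized. * A $((k,n,d))$ communication efficient QTS (CE-QTS) scheme, $k<d\le n$: a $((k,n))$ QTS scheme together with, for every set $D$ of $d$ parties, local quantum operations by which each party $j\in D$ produces from its share a register $H_{j,D}$ of qudits to be sent to a combiner, and a quantum operation by which the combiner recovers every secret from these registers, such that $$\mathrm{CC}_n(d):=\max_{|D|=d}\sum_{j\in D}|H_{j,D}|\;<\;\mathrm{CC}_n(k):=\max_{|K|=k}\sum_{j\in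 K}|S_j| .$$ (When $k$ parties are contacted, the combiner downloads their full shares.) **Theorem (Concatenation framework for fixed $d$ CE-QTS).** Let $k<d\le n$, $m\ge1$, and let a $((d,n+d-k;k-1))$ ramp QSS scheme for a secret of $m$ qudits of dimension $q$ be given. 1. Denote its shares by $A_1,\dots,A_{n+d-k}$, in any order in which the last $d-k$ shares are the largest, i.e. $|A_j|\le|A_\ell|$ whenever $j\le n<\ell$. Let a $((k,n))$ QTS scheme over qudits of dimension $q$ be given whose secret register is $(A_{n+1},\dots,A_{n+d-k})$. Encode the secret with the ramp scheme, encode $(A_{n+1},\dots,A_{n+d-k})$ with the QTS scheme into $B_1,\dots,B_n$, and give $S_j=(A_j,B_j)$ to party $j$, for $1\le j\le n$. This encoding is a $((k,n,d))$ CE-QTS scheme. More precisely: * It is a $((k,n))$ QTS scheme. * For every $K\subseteq[n]$ with $|K|=k$, the secret is recovered from the full shares $S_j$, $j\in K$, as follows: apply any recovery operation of the QTS scheme for $K$ to $(B_j)_{j\in K}$ to obtain $A_{n+1},\dots,A_{n+d-k}$, then apply any recovery operation of the ramp scheme to these together with $(A_j)_{j\in K}$. * For every $D\subseteq[n]$ with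 $|D|=d$, the secret is recovered from the first layers $(A_j)_{j\in D}$ alone, by any recovery operation of the ramp scheme for these $d$ shares. * The costs of these two recoveries satisfy $$\mathrm{CC}_n(d)=\max_{|D|=d}\sum_{j\in D}|A_j|\;<\;\mathrm{CC}_n(k)=\max_{|K|=k}\sum_{j\in K}\bigl(|A_j|+|B_j|\bigr).$$ 2. If a $((k,n))$ QTS scheme over qudits of dimension $q$ exists for a secret of some number $m'\ge1$ of qudits, then an order of the ramp shares and a QTS scheme as in part 1 exist. In particular a $((k,n,d))$ CE-QTS scheme for a secret of $m$ qudits of dimension $q$ exists. -/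

import Mathlib

open scoped BigOperators Matrix ComplexOrder

/-! ### Registers of qudits and quantum operations -/

/-- Operators on a register of `q`-dimensional qudits labelled by `P`, i.e. on `(ℂ^q)^{⊗ P}`,
written as matrices in the standard basis `|x⟩`, `x : P → Fin q`. -/
abbrev RegOp (q : ℕ) (P : Type) : Type := Matrix (P → Fin q) (P → Fin q) ℂ

/-- Density operators. -/
def IsDensityOp {q : ℕ} {P : Type} [Fintype P] [DecidableEq P] (ρ : RegOp q P) : Prop :=
  ρ.PosSemidef ∧ ρ.trace = 1

/-- Quantum operations (completely positive trace-preserving maps) between registers, in Kraus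
form: `X ↦ ∑ᵢ Kᵢ X Kᵢ†` with `∑ᵢ Kᵢ† Kᵢ = 1`. -/
def IsQuantumOp {q : ℕ} {P P' : Type} [Fintype P] [DecidableEq P] [Fintype P'] [DecidableEq P']
    (Φ : RegOp q P →ₗ[ℂ] RegOp q P') : Prop :=
  ∃ (κ : Type) (_ : Fintype κ) (K : κ → Matrix (P' → Fin q) (P → Fin q) ℂ),
    (∑ i, (K i)ᴴ * K i) = 1 ∧ ∀ X, Φ X = ∑ i, K i * X * (K i)ᴴ

/-- Renaming the qudits of a register. -/
def relabelOp (q : ℕ) {P P' : Type} (e : P ≃ P') : RegOp q P →ₗ[ℂ] RegOp q P' where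
  toFun X := Matrix.of fun a b => X (fun p => a (e p)) (fun p => b (e p))
  map_add' _ _ := rfl
  map_smul' _ _ := rfl

open Classical in
/-- The partial trace that keeps the qudits in the image of `f` and traces out all others. -/
noncomputable def marginalOp (q : ℕ) {P P' : Type} [Fintype P] [DecidableEq P] (f : P' ↪ P) :
    RegOp q P →ₗ[ℂ] RegOp q P' where
  toFun X := Matrix.of fun a b => ∑ x : P → Fin q, ∑ y : P → Fin q,
    if (∀ p, x (f p) = a p) ∧ (∀ p, y (f p) = b p) ∧ (∀ p, p ∉ Set.range f → x p = y p)
      then X x y else 0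
  map_add' X Y := by
    ext a b
    simp only [Matrix.of_apply, Matrix.add_apply, ← Finset.sum_add_distrib]
    refine Finset.sum_congr rfl fun x _ => Finset.sum_congr rfl fun y _ => ?_
    split_ifs <;> simp
  map_smul' c X := by
    ext a b
    simp only [Matrix.of_apply, Matrix.smul_apply, Finset.smul_sum, RingHom.id_apply]
    refine Finset.sum_congr rfl fun x _ => Finset.sum_congr rfl fun y _ => ?_
    split_ifs <;> simp

/-- `id ⊗ Φ`: the map `Φ` acts on the second part of a register, nothing happens to the first. -/
def idTensorOp {q : ℕ} (C : Type) {P P' : Type} (Φ : RegOp q P →ₗ[ℂ] RegOp q P') :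
    RegOp q (C ⊕ P) →ₗ[ℂ] RegOp q (C ⊕ P') where
  toFun X := Matrix.of fun a b =>
    Φ (Matrix.of fun x y => X (Sum.elim (fun c => a (.inl c)) x) (Sum.elim (fun c => b (.inl c)) y))
      (fun p => a (.inr p)) (fun p => b (.inr p))
  map_add' X Y := by
    ext a b
    simp only [Matrix.of_apply, Matrix.add_apply]
    rw [← Matrix.add_apply, ← map_add]
    rfl
  map_smul' c X := by
    ext a b
    simp only [Matrix.of_apply, Matrix.smul_apply, RingHom.id_apply]
    rw [← Matrix.smul_apply, ← map_smul]
    rfl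

/-- `⨂ⱼ Φⱼ`: each `Φⱼ` acts locally on the `j`-th part of a register. On matrix units it is
`|x⟩⟨y| ↦ ⨂ⱼ Φⱼ(|xⱼ⟩⟨yⱼ|)`. -/
noncomputable def localOp {q : ℕ} {κ : Type} [Fintype κ] [DecidableEq κ] {α β : κ → Type}
    [∀ j, Fintype (α j)] [∀ j, DecidableEq (α j)]
    (Φ : ∀ j, RegOp q (α j) →ₗ[ℂ] RegOp q (β j)) :
    RegOp q (Σ j, α j) →ₗ[ℂ] RegOp q (Σ j, β j) where
  toFun X := Matrix.of fun a b => ∑ x : (Σ j, α j) → Fin q, ∑ y : (Σ j, α j) → Fin q,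
    X x y * ∏ j, Φ j (Matrix.single (fun p => x ⟨j, p⟩) (fun p => y ⟨j, p⟩) 1)
      (fun p => a ⟨j, p⟩) (fun p => b ⟨j, p⟩)
  map_add' X Y := by
    ext a b
    simp only [Matrix.of_apply, Matrix.add_apply, add_mul, Finset.sum_add_distrib]
  map_smul' c X := by
    ext a b
    simp only [Matrix.of_apply, Matrix.smul_apply, Finset.mul_sum, RingHom.id_apply, smul_eq_mul,
      mul_assoc]

/-! Helper facts: the operations used by the encoder are quantum operations. -/

theorem IsQuantumOp.comp {q : ℕ} {P P' P'' : Type} [Fintype P] [DecidableEq P] [Fintype P']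
    [DecidableEq P'] [Fintype P''] [DecidableEq P'']
    {Ψ : RegOp q P' →ₗ[ℂ] RegOp q P''} {Φ : RegOp q P →ₗ[ℂ] RegOp q P'}
    (hΨ : IsQuantumOp Ψ) (hΦ : IsQuantumOp Φ) : IsQuantumOp (Ψ ∘ₗ Φ) := by
  obtain ⟨κ, _, K, hK, hK'⟩ := hΨ
  obtain ⟨μ, _, L, hL, hL'⟩ := hΦ
  refine ⟨μ × κ, inferInstance, fun i => K i.2 * L i.1, ?_, fun X => ?_⟩
  · have h : ∀ j i, (K i * L j)ᴴ * (K i * L j) = (L j)ᴴ * ((K i)ᴴ * K i) * L j := by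
      intro j i
      simp only [Matrix.conjTranspose_mul, Matrix.mul_assoc]
    simp only [Fintype.sum_prod_type, h]
    simp only [← Matrix.sum_mul, ← Matrix.mul_sum, hK, Matrix.mul_one, hL]
  · simp only [LinearMap.comp_apply, hK', hL', Fintype.sum_prod_type_right, Matrix.mul_sum,
      Matrix.sum_mul, Matrix.conjTranspose_mul, Matrix.mul_assoc]

theorem isQuantumOp_relabelOp (q : ℕ) {P P' : Type} [Fintype P] [DecidableEq P] [Fintype P']
    [DecidableEq P'] (e : P ≃ P') : IsQuantumOp (relabelOp q e) := by
  let g : (P' → Fin q) ≃ (P → Fin q) := e.symm.arrowCongr (Equiv.refl _)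
  refine ⟨Unit, inferInstance,
    fun _ => (1 : Matrix (P → Fin q) (P → Fin q) ℂ).submatrix g id, ?_, fun X => ?_⟩
  · rw [Fintype.sum_unique, Matrix.conjTranspose_submatrix, Matrix.submatrix_mul_equiv]
    simp
  · rw [Fintype.sum_unique, Matrix.conjTranspose_submatrix]
    ext a b
    change X (g a) (g b) = _
    simp [Matrix.mul_apply, Matrix.one_apply]

theorem isQuantumOp_idTensorOp {q : ℕ} (C : Type) {P P' : Type} [Fintype C] [DecidableEq C]
    [Fintype P] [DecidableEq P] [Fintype P'] [DecidableEq P']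
    {Φ : RegOp q P →ₗ[ℂ] RegOp q P'} (hΦ : IsQuantumOp Φ) : IsQuantumOp (idTensorOp C Φ) := by
  obtain ⟨κ, _, K, hK, hK'⟩ := hΦ
  let s : ∀ R : Type, (C ⊕ R → Fin q) ≃ (C → Fin q) × (R → Fin q) :=
    fun R => Equiv.sumArrowEquivProdArrow C R (Fin q)
  refine ⟨κ, inferInstance, fun i =>
    (Matrix.kroneckerMap (· * ·) (1 : Matrix (C → Fin q) (C → Fin q) ℂ) (K i)).submatrix
      (s P') (s P), ?_, fun X => ?_⟩
  · have h : ∀ i, ((Matrix.kroneckerMap (· * ·) (1 : Matrix (C → Fin q) (C → Fin q) ℂ)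
        (K i)).submatrix (s P') (s P))ᴴ *
        (Matrix.kroneckerMap (· * ·) (1 : Matrix (C → Fin q) (C → Fin q) ℂ)
        (K i)).submatrix (s P') (s P) =
        (Matrix.kroneckerMap (· * ·) (1 : Matrix (C → Fin q) (C → Fin q) ℂ)
          ((K i)ᴴ * K i)).submatrix (s P) (s P) := by
      intro i
      rw [Matrix.conjTranspose_submatrix, Matrix.submatrix_mul_equiv,
        Matrix.conjTranspose_kronecker, ← Matrix.mul_kronecker_mul]
      simp
    simp only [h]
    ext a b
    have h2 := congrFun (congrFun hK (fun p => a (.inr p))) (fun p => b (.inr p))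
    rw [Matrix.sum_apply] at h2
    have hab : a = b ↔ (fun c => a (Sum.inl c)) = (fun c => b (Sum.inl c)) ∧
        (fun p => a (Sum.inr p)) = (fun p => b (Sum.inr p)) := by
      rw [← (s P).injective.eq_iff, Prod.ext_iff]
      rfl
    simp only [Matrix.sum_apply, Matrix.submatrix_apply, Matrix.kroneckerMap_apply,
      ← Finset.mul_sum]
    change (1 : Matrix (C → Fin q) (C → Fin q) ℂ) (fun c => a (Sum.inl c)) (fun c => b (Sum.inl c))
      * ∑ i, ((K i)ᴴ * K i) (fun p => a (.inr p)) (fun p => b (.inr p)) = _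
    rw [h2]
    simp only [Matrix.one_apply, hab]
    split_ifs <;> simp_all
  · ext a b
    simp only [idTensorOp, LinearMap.coe_mk, AddHom.coe_mk, Matrix.of_apply, hK',
      Matrix.sum_apply]
    refine Finset.sum_congr rfl fun i _ => ?_
    simp only [Matrix.mul_apply, Matrix.conjTranspose_apply, Matrix.submatrix_apply,
      Matrix.kroneckerMap_apply, Matrix.of_apply]
    rw [← (s P).symm.sum_comp, Fintype.sum_prod_type,
      Finset.sum_eq_single (fun c => b (Sum.inl c))]
    · refine Finset.sum_congr rfl fun y _ => ?_
      rw [← (s P).symm.sum_comp, Fintype.sum_prod_type,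
        Finset.sum_eq_single (fun c => a (Sum.inl c))]
      · have h1 : ∀ (a : C ⊕ P' → Fin q) (x : P → Fin q),
            (1 : Matrix (C → Fin q) (C → Fin q) ℂ) (s P' a).1
              (s P ((s P).symm (fun c => a (Sum.inl c), x))).1 = 1 :=
          fun a x => Matrix.one_apply_eq (fun c => a (Sum.inl c))
        simp only [h1]
        simp [s, Equiv.sumArrowEquivProdArrow, Function.comp_def]
      · intro c _ hc
        refine Finset.sum_eq_zero fun x _ => ?_
        simp [s, Equiv.sumArrowEquivProdArrow, Function.comp_def, Matrix.one_apply, hc.symm]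
      · simp
    · intro c _ hc
      refine Finset.sum_eq_zero fun x _ => ?_
      simp [s, Equiv.sumArrowEquivProdArrow, Function.comp_def, Matrix.one_apply, hc.symm]
    · simp

/-! ### Quantum secret sharing -/

/-- The encoding of a quantum secret, held in a register of `q`-dimensional qudits labelled by `M`,
into shares for the parties `ι`; the share of party `j` consists of the qudits `Q j`. The encoding
is an arbitrary quantum operation, so pure state and mixed state schemes are both covered. -/
structure QSSScheme (q : ℕ) (M : Type) [Fintype M] [DecidableEq M] (ι : Type) [Fintype ι]
    [DecidableEq ι] : Type 1 where
  Q : ι → Type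
  fintypeQ : ∀ j, Fintype (Q j)
  decEqQ : ∀ j, DecidableEq (Q j)
  enc : RegOp q M →ₗ[ℂ] RegOp q (Σ j, Q j)
  enc_isQuantumOp : IsQuantumOp enc

attribute [instance] QSSScheme.fintypeQ QSSScheme.decEqQ

namespace QSSScheme

variable {q : ℕ} {M : Type} [Fintype M] [DecidableEq M] {ι : Type} [Fintype ι] [DecidableEq ι]

/-- The size of the share of party `j`, in qudits. -/
def size (S : QSSScheme q M ι) (j : ι) : ℕ := Fintype.card (S.Q j)

/-- The joint state of the shares of the (distinct) parties `f i`, as a function of the secret. -/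
noncomputable def reduced (S : QSSScheme q M ι) {κ : Type} (f : κ ↪ ι) :
    RegOp q M →ₗ[ℂ] RegOp q (Σ i, S.Q (f i)) :=
  marginalOp q ⟨fun p : Σ i, S.Q (f i) => (⟨f p.1, p.2⟩ : Σ j, S.Q j), by
    rintro ⟨i, x⟩ ⟨i', x'⟩ h
    obtain ⟨h1, h2⟩ := Sigma.mk.inj_iff.mp h
    obtain rfl := f.injective h1
    obtain rfl := eq_of_heq h2
    rfl⟩ ∘ₗ S.enc

/-- The members of a set of parties, as an embedding. -/
abbrev members (X : Finset ι) : {j // j ∈ X} ↪ ι := Function.Embedding.subtype _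

/-- `dec` is a quantum operation that recovers every secret from the shares of the parties `f i`. -/
def Recovers (S : QSSScheme q M ι) {κ : Type} [Fintype κ] [DecidableEq κ] (f : κ ↪ ι)
    (dec : RegOp q (Σ i, S.Q (f i)) →ₗ[ℂ] RegOp q M) : Prop :=
  IsQuantumOp dec ∧ ∀ ρ, IsDensityOp ρ → dec (S.reduced f ρ) = ρ

/-- `X` is authorized: its members can recover the secret from their shares. -/
def Authorized (S : QSSScheme q M ι) (X : Finset ι) : Prop :=
  ∃ dec, S.Recovers (members X) dec

/-- `X` is unauthorized: the joint state of its shares does not depend on the secret. -/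
def Unauthorized (S : QSSScheme q M ι) (X : Finset ι) : Prop :=
  ∃ τ, ∀ ρ, IsDensityOp ρ → S.reduced (members X) ρ = τ

/-- `((k,n))` quantum threshold schemes, `1 < k ≤ n ≤ 2k-1`, where `n` is the number of parties. -/
def IsQTS (S : QSSScheme q M ι) (k : ℕ) : Prop :=
  (1 < k ∧ k ≤ Fintype.card ι ∧ Fintype.card ι + 1 ≤ 2 * k) ∧
  (∀ X : Finset ι, k ≤ X.card → S.Authorized X) ∧
  (∀ X : Finset ι, X.card < k → S.Unauthorized X)

/-- `((t,n;z))` ramp schemes, `1 ≤ z < t ≤ n ≤ t+z`, where `n` is the number of parties. -/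
def IsRamp (S : QSSScheme q M ι) (t z : ℕ) : Prop :=
  (1 ≤ z ∧ z < t ∧ t ≤ Fintype.card ι ∧ Fintype.card ι ≤ t + z) ∧
  (∀ X : Finset ι, t ≤ X.card → S.Authorized X) ∧
  (∀ X : Finset ι, X.card ≤ z → S.Unauthorized X)

/-- The combiner recovers every secret with `dec` after each party `f i` has applied the local
operation `part i` to its share and has sent the resulting register `H i`. -/
def RecoversFromParts (S : QSSScheme q M ι) {κ : Type} [Fintype κ] [DecidableEq κ] (f : κ ↪ ι)
    {H : κ → Type} [∀ i, Fintype (H i)] [∀ i, DecidableEq (H i)]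
    (part : ∀ i, RegOp q (S.Q (f i)) →ₗ[ℂ] RegOp q (H i))
    (dec : RegOp q (Σ i, H i) →ₗ[ℂ] RegOp q M) : Prop :=
  (∀ i, IsQuantumOp (part i)) ∧ IsQuantumOp dec ∧
  ∀ ρ, IsDensityOp ρ → dec (localOp part (S.reduced f ρ)) = ρ

/-- A recovery of the secret by a combiner from partial shares sent by the members of `X`. -/
structure Download (S : QSSScheme q M ι) (X : Finset ι) : Type 1 where
  H : {j // j ∈ X} → Type
  fintypeH : ∀ j, Fintype (H j)
  decEqH : ∀ j, DecidableEq (H j)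
  part : ∀ j, RegOp q (S.Q (members X j)) →ₗ[ℂ] RegOp q (H j)
  dec : RegOp q (Σ j, H j) →ₗ[ℂ] RegOp q M
  recovers : S.RecoversFromParts (members X) part dec

attribute [instance] Download.fintypeH Download.decEqH

/-- The number of qudits sent to the combiner. -/
def Download.cost {S : QSSScheme q M ι} {X : Finset ι} (P : S.Download X) : ℕ :=
  ∑ j, Fintype.card (P.H j)

/-- The maximal cost over all sets of `e` parties. -/
def maxCost (e : ℕ) (cost : {X : Finset ι // X.card = e} → ℕ) : ℕ :=
  Finset.univ.sup cost

/-- `CC_n(k)` at the threshold `k`: the combiner downloads the full shares of `k` parties. -/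
def thresholdCost (S : QSSScheme q M ι) (k : ℕ) : ℕ :=
  maxCost k fun X => ∑ j ∈ X.1, S.size j

/-- `((k,n,d))` communication efficient threshold schemes, `k < d ≤ n`: threshold schemes in which
any `d` parties can enable the recovery by sending parts of their shares, with
`CC_n(d) < CC_n(k)`. -/
def IsCEQTS (S : QSSScheme q M ι) (k d : ℕ) : Prop :=
  S.IsQTS k ∧ k < d ∧ d ≤ Fintype.card ι ∧
  ∃ P : ∀ D : {D : Finset ι // D.card = d}, S.Download D.1,
    maxCost d (fun D => (P D).cost) < S.thresholdCost k

/-! ### The concatenation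

A scheme `R` with parties `ι'` is given, together with a labelling `σ : ι ⊕ ε ≃ ι'` of its shares
by `ι` (first layer shares) and `ε` (extra shares). -/

variable {ε ι' : Type} [Fintype ε] [DecidableEq ε] [Fintype ι'] [DecidableEq ι']

/-- The extra shares are the largest ones. -/
def ExtraLargest (R : QSSScheme q M ι') (σ : ι ⊕ ε ≃ ι') : Prop :=
  ∀ j l, R.size (σ (.inl j)) ≤ R.size (σ (.inr l))

/-- The qudits of all shares of `R`, split into first layer and extra shares. -/
def splitShares (R : QSSScheme q M ι') (σ : ι ⊕ ε ≃ ι') :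
    (Σ i, R.Q i) ≃ (Σ j, R.Q (σ (.inl j))) ⊕ (Σ l, R.Q (σ (.inr l))) :=
  (Equiv.sigmaCongrLeft (β := R.Q) σ).symm.trans (Equiv.sumSigmaDistrib fun x => R.Q (σ x))

/-- Encoding: encode the secret with `R`, encode the extra shares with `T`, and give to party `j`
the pair of its share of `R` (layer 1) and its share of `T` (layer 2). -/
noncomputable def concat (R : QSSScheme q M ι') (σ : ι ⊕ ε ≃ ι')
    (T : QSSScheme q (Σ l, R.Q (σ (.inr l))) ι) : QSSScheme q M ι where
  Q j := R.Q (σ (.inl j)) ⊕ T.Q j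
  fintypeQ _ := inferInstance
  decEqQ _ := inferInstance
  enc := relabelOp q (Equiv.sigmaSumDistrib (fun j => R.Q (σ (.inl j))) T.Q).symm ∘ₗ
    idTensorOp (Σ j, R.Q (σ (.inl j))) T.enc ∘ₗ relabelOp q (R.splitShares σ) ∘ₗ R.enc
  enc_isQuantumOp := (isQuantumOp_relabelOp q _).comp <|
    (isQuantumOp_idTensorOp _ T.enc_isQuantumOp).comp <|
      (isQuantumOp_relabelOp q _).comp R.enc_isQuantumOp

/-- The parties of `R` whose shares are the layer 1 of the members of `D`. -/
def layerOneParties (σ : ι ⊕ ε ≃ ι') (D : Finset ι) : {j // j ∈ D} ↪ ι' :=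
  ((members D).trans Function.Embedding.inl).trans σ.toEmbedding

/-- The parties of `R` whose shares are the layer 1 of the members of `K`, or extra shares. -/
def extendedParties (σ : ι ⊕ ε ≃ ι') (K : Finset ι) : {j // j ∈ K} ⊕ ε ↪ ι' :=
  ((members K).sumMap (Function.Embedding.refl ε)).trans σ.toEmbedding

/-- Sending layer 1 of a share: layer 2 is traced out. -/
noncomputable def layerOne (R : QSSScheme q M ι') (σ : ι ⊕ ε ≃ ι')
    (T : QSSScheme q (Σ l, R.Q (σ (.inr l))) ι) (D : Finset ι) (j : {j // j ∈ D}) :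
    RegOp q ((R.concat σ T).Q (members D j)) →ₗ[ℂ] RegOp q (R.Q (layerOneParties σ D j)) :=
  marginalOp q (P := R.Q (σ (.inl j.1)) ⊕ T.Q j.1) Function.Embedding.inl

/-- Recovery from full shares of the members of `K`: recover the extra shares from layer 2 with
`decT`, then recover the secret from them and layer 1 with `decR`. -/
noncomputable def twoLayerDec (R : QSSScheme q M ι') (σ : ι ⊕ ε ≃ ι')
    (T : QSSScheme q (Σ l, R.Q (σ (.inr l))) ι) (K : Finset ι)
    (decT : RegOp q (Σ j, T.Q (members K j)) →ₗ[ℂ] RegOp q (Σ l, R.Q (σ (.inr l))))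
    (decR : RegOp q (Σ x, R.Q (extendedParties σ K x)) →ₗ[ℂ] RegOp q M) :
    RegOp q (Σ j, (R.concat σ T).Q (members K j)) →ₗ[ℂ] RegOp q M :=
  decR ∘ₗ
    relabelOp q (Equiv.sumSigmaDistrib fun x => R.Q (extendedParties σ K x)).symm ∘ₗ
    idTensorOp (Σ j : {j // j ∈ K}, R.Q (σ (.inl j.1))) decT ∘ₗ
    relabelOp q (Equiv.sigmaSumDistrib (fun j : {j // j ∈ K} => R.Q (σ (.inl j.1)))
      fun j => T.Q (members K j))

end QSSScheme

/-! Layer 2 stands in for the `d - k` extra ramp shares. Any `k` parties rebuild them from layer 2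
and then hold `k + (d - k) = d` ramp shares; any `d` parties already hold `d` ramp shares in layer
1. For fewer than `k` parties, layer 2 is in a fixed state uncorrelated with layer 1, and layer 1
shows at most `k - 1` ramp shares, whose state is independent of the secret (`concat_unauthorized`).

The extra shares may be entangled with layer 1, so the properties of the threshold scheme must hold
beside a spectator register. Since density operators span (`RegOp.ext_of_density`), recovery is the
linear identity `dec ∘ reduced = id`, and an unauthorized set sees the map `Y ↦ tr Y • τ`. Both
identities survive tensoring with the identity map. `concat_reduced` puts the state of a set of
parties in the form to which they apply.

For the costs, take `K ⊆ D` of sizes `k` and `d`. The `d - k` layer 1 shares of `D \ K` are together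
no larger than the extra shares, which are the largest ones. The extra shares form the secret of the
threshold scheme, and a nonempty secret is strictly smaller than the shares of any `k` parties
(`IsQTS.card_lt_sum_size`): in case of equality the reduced map onto these shares would be
surjective, although dropping one share must leave a fixed state.

For existence, the ramp shares are sorted by size. A threshold scheme for a secret of any size comes
from sharing many blocks independently and padding a smaller secret with a fixed basis state. -/

/-! ### Density operators span -/

section Span

open scoped MatrixOrder Matrix.Norms.L2Operator

/-- Linear maps that agree on density operators are equal. -/
theorem RegOp.ext_of_density {q : ℕ} {P : Type} [Fintype P] [DecidableEq P] {V : Type*}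
    [AddCommGroup V] [Module ℂ V] {F G : RegOp q P →ₗ[ℂ] V}
    (h : ∀ ρ, IsDensityOp ρ → F ρ = G ρ) : F = G := by
  refine LinearMap.ext_on (CStarAlgebra.span_nonneg (A := RegOp q P)) fun X hX => ?_
  have hX : X.PosSemidef := Matrix.nonneg_iff_posSemidef.mp hX
  -- A positive semidefinite operator is zero or a positive multiple of a density operator.
  by_cases ht : X.trace = 0
  · rw [hX.trace_eq_zero_iff.mp ht, map_zero, map_zero]
  · have h1 : 0 ≤ (X.trace)⁻¹ := inv_nonneg_of_nonneg hX.trace_nonneg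
    have h2 := h ((X.trace)⁻¹ • X) ⟨hX.smul h1, by
      rw [Matrix.trace_smul, smul_eq_mul, inv_mul_cancel₀ ht]⟩
    rw [map_smul, map_smul] at h2
    exact smul_right_injective V (inv_ne_zero ht) h2

end Span

/-! ### Matrix units and product operators -/

section Registers

variable {q : ℕ} {A A' B B' C P P' P'' : Type}

/-- Linear maps that agree on matrix units are equal. -/
theorem RegOp.ext_single [Finite P] {V : Type*} [AddCommGroup V] [Module ℂ V]
    [DecidableEq (P → Fin q)] {F G : RegOp q P →ₗ[ℂ] V}
    (h : ∀ x y, F (Matrix.single x y 1) = G (Matrix.single x y 1)) : F = G := by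
  have := Fintype.ofFinite (P → Fin q)
  refine Matrix.ext_linearMap ℂ fun x y => LinearMap.ext_ring ?_
  simpa using h x y

/-- The tensor product of operators. -/
def tensOp : RegOp q A →ₗ[ℂ] RegOp q B →ₗ[ℂ] RegOp q (A ⊕ B) :=
  LinearMap.mk₂ ℂ
    (fun X Y => Matrix.of fun a b => X (a ∘ Sum.inl) (b ∘ Sum.inl) * Y (a ∘ Sum.inr) (b ∘ Sum.inr))
    (fun _ _ _ => by ext; simp [add_mul]) (fun _ _ _ => by ext; simp [mul_assoc])
    (fun _ _ _ => by ext; simp [mul_add]) (fun _ _ _ => by ext; simp [mul_left_comm])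

theorem tensOp_apply (X : RegOp q A) (Y : RegOp q B) (a b : A ⊕ B → Fin q) :
    tensOp X Y a b = X (a ∘ Sum.inl) (b ∘ Sum.inl) * Y (a ∘ Sum.inr) (b ∘ Sum.inr) := rfl

theorem sum_funext_iff {x y : A ⊕ B → Fin q} :
    x = y ↔ x ∘ Sum.inl = y ∘ Sum.inl ∧ x ∘ Sum.inr = y ∘ Sum.inr := by
  constructor
  · rintro rfl
    exact ⟨rfl, rfl⟩
  · rintro ⟨h1, h2⟩
    funext i
    rcases i with i | i
    · exact congrFun h1 i
    · exact congrFun h2 i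

theorem tensOp_single [DecidableEq (A → Fin q)] [DecidableEq (B → Fin q)]
    [DecidableEq (A ⊕ B → Fin q)] (x y : A ⊕ B → Fin q) :
    tensOp (Matrix.single (x ∘ Sum.inl) (y ∘ Sum.inl) (1 : ℂ))
      (Matrix.single (x ∘ Sum.inr) (y ∘ Sum.inr) 1) = Matrix.single x y 1 := by
  ext a b
  simp only [tensOp_apply, Matrix.single_apply, sum_funext_iff (x := x), sum_funext_iff (x := y)]
  split_ifs <;> simp_all

/-- Linear maps that agree on product operators are equal. -/
theorem RegOp.ext_tens [Finite A] [Finite B] {V : Type*} [AddCommGroup V] [Module ℂ V]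
    {F G : RegOp q (A ⊕ B) →ₗ[ℂ] V} (h : ∀ X Y, F (tensOp X Y) = G (tensOp X Y)) : F = G := by
  classical
  refine RegOp.ext_single fun x y => ?_
  rw [← tensOp_single]
  exact h _ _

theorem idTensorOp_tens (Φ : RegOp q P →ₗ[ℂ] RegOp q P') (X : RegOp q C) (Y : RegOp q P) :
    idTensorOp C Φ (tensOp X Y) = tensOp X (Φ Y) := by
  ext a b
  have h : (Matrix.of fun x y => tensOp X Y (Sum.elim (fun c => a (.inl c)) x)
      (Sum.elim (fun c => b (.inl c)) y)) = X (a ∘ Sum.inl) (b ∘ Sum.inl) • Y := rfl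
  change Φ (Matrix.of fun x y => tensOp X Y (Sum.elim (fun c => a (.inl c)) x)
      (Sum.elim (fun c => b (.inl c)) y)) _ _ = _
  rw [h, map_smul]
  rfl

theorem idTensorOp_comp [Finite C] [Finite P] (Φ : RegOp q P →ₗ[ℂ] RegOp q P')
    (Ψ : RegOp q P' →ₗ[ℂ] RegOp q P'') :
    idTensorOp C Ψ ∘ₗ idTensorOp C Φ = idTensorOp C (Ψ ∘ₗ Φ) :=
  RegOp.ext_tens fun X Y => by simp [idTensorOp_tens]

theorem idTensorOp_id [Finite C] [Finite P] :
    idTensorOp C (LinearMap.id : RegOp q P →ₗ[ℂ] RegOp q P) = LinearMap.id :=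
  RegOp.ext_tens fun X Y => by simp [idTensorOp_tens]

/-! ### Partial traces -/

open Classical in
theorem marginalOp_apply [Fintype P] [DecidableEq P] (f : P' ↪ P) (X : RegOp q P)
    (a b : P' → Fin q) : marginalOp q f X a b = ∑ x : P → Fin q, ∑ y : P → Fin q,
      if (∀ p, x (f p) = a p) ∧ (∀ p, y (f p) = b p) ∧ (∀ p, p ∉ Set.range f → x p = y p)
        then X x y else 0 := rfl

-- Combined with `RegOp.ext_single`, this reduces identities between partial traces to statements
-- about which labels agree outside a range.
open Classical in
theorem marginalOp_single [Fintype P] [DecidableEq P] [DecidableEq (P → Fin q)]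
    [DecidableEq (P' → Fin q)] (f : P' ↪ P) (x y : P → Fin q) :
    marginalOp q f (Matrix.single x y 1) =
      if ∀ p, p ∉ Set.range f → x p = y p then Matrix.single (x ∘ f) (y ∘ f) 1 else 0 := by
  ext a b
  rw [marginalOp_apply, Finset.sum_eq_single x, Finset.sum_eq_single y]
  · have h (u : P → Fin q) (c : P' → Fin q) : (∀ p, u (f p) = c p) ↔ u ∘ f = c :=
      funext_iff.symm
    simp only [h]
    split_ifs <;> simp_all
  · intro z _ hz
    simp [hz.symm]
  · simp
  · intro z _ hz
    simp [hz.symm]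
  · simp

theorem marginalOp_comp [Fintype P] [DecidableEq P] [Fintype P'] [DecidableEq P'] (f : P' ↪ P)
    (g : P'' ↪ P') : marginalOp q g ∘ₗ marginalOp q f = marginalOp q (g.trans f) := by
  classical
  refine RegOp.ext_single fun x y => ?_
  rw [LinearMap.comp_apply, marginalOp_single, marginalOp_single]
  by_cases h1 : ∀ p, p ∉ Set.range f → x p = y p
  · rw [if_pos h1, marginalOp_single]
    -- A qudit missed by `g.trans f` is either missed by `f`, or kept by `f` and then missed by `g`.
    have h2 : (∀ p, p ∉ Set.range g → (x ∘ f) p = (y ∘ f) p) ↔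
        ∀ p, p ∉ Set.range (g.trans f) → x p = y p := by
      constructor
      · intro h p hp
        by_cases hpf : p ∈ Set.range f
        · obtain ⟨r, rfl⟩ := hpf
          refine h r fun ⟨s, hs⟩ => hp ⟨s, ?_⟩
          simp [hs]
        · exact h1 p hpf
      · intro h p hp
        refine h (f p) fun ⟨s, hs⟩ => hp ⟨s, f.injective hs⟩
    simp only [h2]
    rfl
  · rw [if_neg h1, map_zero, if_neg]
    exact fun h => h1 fun p hp => h p fun ⟨s, hs⟩ => hp ⟨g s, hs⟩

theorem marginalOp_marginalOp [Fintype P] [DecidableEq P] [Fintype P'] [DecidableEq P']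
    (f : P' ↪ P) (g : P'' ↪ P') (X : RegOp q P) :
    marginalOp q g (marginalOp q f X) = marginalOp q (g.trans f) X :=
  LinearMap.congr_fun (marginalOp_comp f g) X

/-- With `marginalOp_comp`, any chain of relabelings and partial traces collapses to one partial
trace, so two chains can be compared through their embeddings of labels. -/
theorem relabelOp_eq_marginalOp [Fintype P] [DecidableEq P] (e : P ≃ P') :
    relabelOp q e = marginalOp q e.symm.toEmbedding := by
  classical
  refine RegOp.ext_single fun x y => ?_
  rw [marginalOp_single, if_pos (by intro p hp; exact absurd ⟨e p, by simp⟩ hp)]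
  ext a b
  change Matrix.single x y (1 : ℂ) (a ∘ e) (b ∘ e) = _
  simp only [Matrix.single_apply]
  congr 1
  simp only [Equiv.coe_toEmbedding, Equiv.comp_symm_eq]

theorem marginalOp_refl [Fintype P] [DecidableEq P] :
    marginalOp q (Function.Embedding.refl P) = LinearMap.id := by
  rw [← Equiv.refl_toEmbedding, ← Equiv.refl_symm, ← relabelOp_eq_marginalOp]
  rfl

theorem marginalOp_tens [Fintype A] [DecidableEq A] [Fintype B] [DecidableEq B] (f : A' ↪ A)
    (g : B' ↪ B) (X : RegOp q A) (Y : RegOp q B) :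
    marginalOp q (f.sumMap g) (tensOp X Y) = tensOp (marginalOp q f X) (marginalOp q g Y) := by
  classical
  have h : (tensOp (q := q)).compr₂ (marginalOp q (f.sumMap g)) =
      tensOp.compl₁₂ (marginalOp q f) (marginalOp q g) := by
    refine RegOp.ext_single fun x y => RegOp.ext_single fun z w => ?_
    simp only [LinearMap.compr₂_apply, LinearMap.compl₁₂_apply, marginalOp_single]
    have h1 := tensOp_single (Sum.elim x z) (Sum.elim y w)
    simp only [Sum.elim_comp_inl, Sum.elim_comp_inr] at h1
    rw [h1, marginalOp_single, ← tensOp_single]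
    have h2 : (∀ p, p ∉ Set.range (f.sumMap g) → Sum.elim x z p = Sum.elim y w p) ↔
        (∀ p, p ∉ Set.range f → x p = y p) ∧ (∀ p, p ∉ Set.range g → z p = w p) := by
      simp [Sum.forall]
    simp only [h2]
    by_cases h3 : ∀ p, p ∉ Set.range f → x p = y p
    · by_cases h4 : ∀ p, p ∉ Set.range g → z p = w p
      · rw [if_pos ⟨h3, h4⟩, if_pos h3, if_pos h4]
        rfl
      · rw [if_neg (fun h => h4 h.2), if_neg h4, map_zero]
    · rw [if_neg (fun h => h3 h.1), if_neg h3, map_zero, LinearMap.zero_apply]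
  exact LinearMap.congr_fun₂ h X Y

theorem marginalOp_inl_tens [Fintype A] [DecidableEq A] [Fintype B] [DecidableEq B]
    (X : RegOp q A) (Y : RegOp q B) :
    marginalOp q (Function.Embedding.inl : A ↪ A ⊕ B) (tensOp X Y) = Y.trace • X := by
  classical
  have h : (tensOp (q := q)).compr₂ (marginalOp q (Function.Embedding.inl : A ↪ A ⊕ B)) =
      (LinearMap.lsmul ℂ (RegOp q A) ∘ₗ Matrix.traceLinearMap (B → Fin q) ℂ ℂ).flip := by
    refine RegOp.ext_single fun x y => RegOp.ext_single fun z w => ?_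
    have h1 := tensOp_single (Sum.elim x z) (Sum.elim y w)
    simp only [Sum.elim_comp_inl, Sum.elim_comp_inr] at h1
    simp only [LinearMap.compr₂_apply, h1, marginalOp_single]
    have h2 : (∀ p, p ∉ Set.range (Function.Embedding.inl : A ↪ A ⊕ B) →
        Sum.elim x z p = Sum.elim y w p) ↔ z = w := by
      simp [Sum.forall, funext_iff]
    simp only [h2]
    by_cases h3 : z = w
    · subst h3
      simp
      rfl
    · simp [h3, Matrix.trace_single_eq_of_ne _ _ _ h3]
  exact LinearMap.congr_fun₂ h X Y

/-- Locality: tracing out spectator qudits commutes with an operation that does not touch them. It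
suffices to check this on product operators. -/
theorem marginalOp_comp_idTensorOp [Fintype C] [DecidableEq C] [Fintype P] [DecidableEq P]
    [Fintype P'] [DecidableEq P'] [Fintype A] [DecidableEq A] (f : A ↪ C) (g : P'' ↪ P')
    (Φ : RegOp q P →ₗ[ℂ] RegOp q P') :
    marginalOp q (f.sumMap g) ∘ₗ idTensorOp C Φ =
      idTensorOp A (marginalOp q g ∘ₗ Φ) ∘ₗ
        marginalOp q (f.sumMap (Function.Embedding.refl P)) :=
  RegOp.ext_tens fun X Y => by
    simp [idTensorOp_tens, marginalOp_tens, marginalOp_refl]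

/-! ### Quantum operations -/

theorem IsQuantumOp.trace_apply [Fintype P] [DecidableEq P] [Fintype P'] [DecidableEq P']
    {Φ : RegOp q P →ₗ[ℂ] RegOp q P'} (hΦ : IsQuantumOp Φ) (X : RegOp q P) :
    (Φ X).trace = X.trace := by
  obtain ⟨κ, _, K, hK, hK'⟩ := hΦ
  rw [hK', Matrix.trace_sum]
  simp only [fun i => Matrix.trace_mul_cycle (K i) X (K i)ᴴ]
  rw [← Matrix.trace_sum, ← Matrix.sum_mul, hK, Matrix.one_mul]

theorem IsQuantumOp.isDensityOp [Fintype P] [DecidableEq P] [Fintype P'] [DecidableEq P']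
    {Φ : RegOp q P →ₗ[ℂ] RegOp q P'} (hΦ : IsQuantumOp Φ) {ρ : RegOp q P}
    (hρ : IsDensityOp ρ) : IsDensityOp (Φ ρ) := by
  refine ⟨?_, (hΦ.trace_apply ρ).trans hρ.2⟩
  obtain ⟨κ, _, K, -, hK'⟩ := hΦ
  rw [hK']
  exact Matrix.posSemidef_sum _ fun i _ => hρ.1.mul_mul_conjTranspose_same (K i)

open Classical in
theorem isQuantumOp_marginalOp [Fintype P] [DecidableEq P] [Fintype P'] [DecidableEq P']
    (f : P' ↪ P) : IsQuantumOp (marginalOp q f) := by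
  let r (x : P → Fin q) : {p // p ∉ Set.range f} → Fin q := fun p => x p
  have hr (x y : P → Fin q) : (∀ p, p ∉ Set.range f → x p = y p) ↔ r x = r y := by
    simp only [r, funext_iff, Subtype.forall]
  have hxy (x y : P → Fin q) : x = y ↔ x ∘ f = y ∘ f ∧ r x = r y := by
    rw [← hr]
    constructor
    · rintro rfl
      exact ⟨rfl, fun _ _ => rfl⟩
    · rintro ⟨h1, h2⟩
      funext p
      by_cases hp : p ∈ Set.range f
      · obtain ⟨s, rfl⟩ := hp
        exact congrFun h1 s
      · exact h2 p hp
  -- The Kraus operator of index `z` is the bra `⟨z|` on the traced-out qudits tensored with the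
  -- identity on the kept ones.
  refine ⟨{p // p ∉ Set.range f} → Fin q, inferInstance,
    fun z => Matrix.of fun a x => if x ∘ f = a ∧ r x = z then 1 else 0, ?_, ?_⟩
  · ext x y
    simp only [Matrix.sum_apply, Matrix.mul_apply, Matrix.conjTranspose_apply, Matrix.of_apply,
      Matrix.one_apply]
    rw [Finset.sum_eq_single (r x), Finset.sum_eq_single (x ∘ f)]
    · simp only [hxy x y, eq_comm (a := y ∘ f), eq_comm (a := r y)]
      by_cases h1 : x ∘ f = y ∘ f <;> by_cases h2 : r x = r y <;> simp [h1, h2]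
    · intro a _ ha
      simp [ha.symm]
    · simp
    · intro z _ hz
      simp [hz.symm]
    · simp
  · intro X
    ext a b
    simp only [marginalOp_apply, Matrix.sum_apply, Matrix.mul_apply, Matrix.conjTranspose_apply,
      Matrix.of_apply, Finset.sum_mul]
    refine Eq.symm ((Finset.sum_congr rfl fun z _ => Finset.sum_comm).trans
      (Finset.sum_comm.trans (Finset.sum_congr rfl fun x _ =>
        Finset.sum_comm.trans (Finset.sum_congr rfl fun y _ => ?_))))
    have hf (u : P → Fin q) (c : P' → Fin q) : (∀ p, u (f p) = c p) ↔ u ∘ f = c :=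
      funext_iff.symm
    rw [Finset.sum_eq_single (r x)]
    · simp only [hf, hr, and_true, eq_comm (a := r y)]
      by_cases h1 : x ∘ f = a <;> by_cases h2 : y ∘ f = b <;> by_cases h3 : r x = r y <;>
        simp [h1, h2, h3]
    · intro z _ hz
      simp [hz.symm]
    · simp

end Registers

section Registers

variable {q : ℕ} {A B C P P' : Type}

/-! ### Local partial traces and replacement maps -/

/-- On matrix units each local factor is a 0/1 indicator, and their product is the indicator of the
conjunction, which is the condition of the global partial trace. -/
theorem localOp_marginalOp {κ : Type} [Fintype κ] [DecidableEq κ] {α β : κ → Type}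
    [∀ j, Fintype (α j)] [∀ j, DecidableEq (α j)] (f : ∀ j, β j ↪ α j) :
    localOp (fun j => marginalOp q (f j)) =
      marginalOp q (Function.Embedding.sigmaMap (Function.Embedding.refl κ) f) := by
  classical
  ext1 X
  ext a b
  rw [marginalOp_apply]
  refine Finset.sum_congr rfl fun x _ => Finset.sum_congr rfl fun y _ => ?_
  have h1 (j : κ) : marginalOp q (f j)
      (Matrix.single (fun p => x ⟨j, p⟩) (fun p => y ⟨j, p⟩) 1) (fun p => a ⟨j, p⟩)
      (fun p => b ⟨j, p⟩) =
      if (∀ p, x ⟨j, f j p⟩ = a ⟨j, p⟩) ∧ (∀ p, y ⟨j, f j p⟩ = b ⟨j, p⟩) ∧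
        (∀ p, p ∉ Set.range (f j) → x ⟨j, p⟩ = y ⟨j, p⟩) then 1 else 0 := by
    rw [marginalOp_single]
    by_cases h : ∀ p, p ∉ Set.range (f j) → x ⟨j, p⟩ = y ⟨j, p⟩
    · rw [if_pos h, Matrix.single_apply]
      simp only [funext_iff, Function.comp_apply]
      exact if_congr ⟨fun h' => ⟨h'.1, h'.2, h⟩, fun h' => ⟨h'.1, h'.2.1⟩⟩ rfl rfl
    · rw [if_neg h, if_neg fun h' => h h'.2.2]
      rfl
  have h2 : ((∀ p, x (Function.Embedding.sigmaMap (Function.Embedding.refl κ) f p) = a p) ∧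
      (∀ p, y (Function.Embedding.sigmaMap (Function.Embedding.refl κ) f p) = b p) ∧
      ∀ p, p ∉ Set.range (Function.Embedding.sigmaMap (Function.Embedding.refl κ) f) →
        x p = y p) ↔ ∀ j, (∀ p, x ⟨j, f j p⟩ = a ⟨j, p⟩) ∧ (∀ p, y ⟨j, f j p⟩ = b ⟨j, p⟩) ∧
        (∀ p, p ∉ Set.range (f j) → x ⟨j, p⟩ = y ⟨j, p⟩) := by
    have h3 (j : κ) (p : α j) : (⟨j, p⟩ : Σ j, α j) ∉
        Set.range (Function.Embedding.sigmaMap (Function.Embedding.refl κ) f) ↔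
        p ∉ Set.range (f j) := by
      refine not_congr ⟨?_, ?_⟩
      · rintro ⟨⟨i, r⟩, h⟩
        obtain ⟨h1, h2⟩ := Sigma.mk.inj_iff.mp h
        obtain rfl : i = j := h1
        exact ⟨r, eq_of_heq h2⟩
      · rintro ⟨r, rfl⟩
        exact ⟨⟨j, r⟩, rfl⟩
    simp only [Sigma.forall, h3, forall_and]
    rfl
  simp only [h1, h2]
  rw [Finset.prod_ite_zero]
  simp

/-- The mechanism of secrecy: an operation that discards its input and prepares `τ` destroys every
correlation with the spectator register. -/
theorem idTensorOp_replace [Fintype C] [DecidableEq C] [Fintype P] [DecidableEq P]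
    {Φ : RegOp q P →ₗ[ℂ] RegOp q P'} {τ : RegOp q P'} (hΦ : ∀ Y, Φ Y = Y.trace • τ)
    (Z : RegOp q (C ⊕ P)) :
    idTensorOp C Φ Z = tensOp (marginalOp q Function.Embedding.inl Z) τ := by
  have h : idTensorOp C Φ = tensOp.flip τ ∘ₗ marginalOp q Function.Embedding.inl :=
    RegOp.ext_tens fun X Y => by
      simp [idTensorOp_tens, hΦ, marginalOp_inl_tens]
  exact LinearMap.congr_fun h Z

/-- No signalling: trace preservation makes an operation on one part invisible on the other. -/
theorem marginalOp_inl_idTensorOp [Fintype C] [DecidableEq C] [Fintype P] [DecidableEq P]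
    [Fintype P'] [DecidableEq P'] {Φ : RegOp q P →ₗ[ℂ] RegOp q P'} (hΦ : IsQuantumOp Φ)
    (Z : RegOp q (C ⊕ P)) :
    marginalOp q Function.Embedding.inl (idTensorOp C Φ Z) =
      marginalOp q Function.Embedding.inl Z := by
  have h : marginalOp q Function.Embedding.inl ∘ₗ idTensorOp C Φ =
      marginalOp q Function.Embedding.inl :=
    RegOp.ext_tens fun X Y => by
      simp [idTensorOp_tens, marginalOp_inl_tens, hΦ.trace_apply]
  exact LinearMap.congr_fun h Z

/-- Conjugation `X ↦ V X V†` with a fixed operator. -/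
def conjOp [Fintype P'] [DecidableEq P'] (V : Matrix (P → Fin q) (P' → Fin q) ℂ) :
    RegOp q P' →ₗ[ℂ] RegOp q P where
  toFun X := V * X * Vᴴ
  map_add' X Y := by rw [Matrix.mul_add, Matrix.add_mul]
  map_smul' c X := by rw [Matrix.mul_smul, Matrix.smul_mul, RingHom.id_apply]

theorem isQuantumOp_conjOp [Fintype P] [DecidableEq P] [Fintype P'] [DecidableEq P']
    {V : Matrix (P → Fin q) (P' → Fin q) ℂ} (hV : Vᴴ * V = 1) : IsQuantumOp (conjOp V) := by
  refine ⟨Unit, inferInstance, fun _ => V, ?_, fun X => ?_⟩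
  · rw [Fintype.sum_unique, hV]
  · rw [Fintype.sum_unique]
    rfl

theorem conjOp_single [Fintype P] [DecidableEq P] [Fintype P'] [DecidableEq P']
    (e : (P' → Fin q) → P → Fin q) (x y : P' → Fin q) :
    conjOp (Matrix.submatrix (1 : Matrix (P → Fin q) (P → Fin q) ℂ) id e) (Matrix.single x y 1) =
      Matrix.single (e x) (e y) 1 := by
  ext a b
  change (Matrix.submatrix (1 : Matrix (P → Fin q) (P → Fin q) ℂ) id e * Matrix.single x y (1 : ℂ) *
    (Matrix.submatrix (1 : Matrix (P → Fin q) (P → Fin q) ℂ) id e)ᴴ) a b = _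
  rw [Matrix.mul_apply, Finset.sum_eq_single y, Matrix.mul_single_apply_same]
  · simp only [Matrix.submatrix_apply, Matrix.conjTranspose_apply, Matrix.one_apply,
      Matrix.single_apply, id_eq, eq_comm (a := a), eq_comm (a := b)]
    by_cases h1 : e x = a <;> by_cases h2 : e y = b <;> simp [h1, h2]
  · intro z _ hz
    rw [Matrix.mul_single_apply_of_ne _ _ _ _ _ hz, zero_mul]
  · simp

/-- Adding qudits in a fixed basis state is a quantum operation undone by tracing them out. -/
theorem exists_marginalOp_comp_eq_id [Fintype P] [DecidableEq P] [Fintype P'] [DecidableEq P']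
    (hq : 0 < q) (f : P' ↪ P) : ∃ Φ : RegOp q P' →ₗ[ℂ] RegOp q P,
      IsQuantumOp Φ ∧ marginalOp q f ∘ₗ Φ = LinearMap.id := by
  -- The added qudits are set to `|0⟩`. The isometry `|x⟩ ↦ |e x⟩` then only needs that `e x`
  -- restricts to `x` along `f` and is independent of `x` elsewhere.
  let e (x : P' → Fin q) : P → Fin q := Function.extend f x fun _ => ⟨0, hq⟩
  have he (x : P' → Fin q) : e x ∘ f = x := Function.extend_comp f.injective _ _
  have he' (x : P' → Fin q) (p : P) (hp : p ∉ Set.range f) : e x p = ⟨0, hq⟩ :=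
    Function.extend_apply' _ _ _ hp
  clear_value e
  refine ⟨conjOp (Matrix.submatrix 1 id e), isQuantumOp_conjOp ?_, ?_⟩
  · rw [Matrix.conjTranspose_submatrix, Matrix.conjTranspose_one,
      ← Matrix.submatrix_mul _ _ e id e Function.bijective_id, Matrix.one_mul]
    exact Matrix.submatrix_one e (Function.LeftInverse.injective (g := (· ∘ f)) he)
  · refine RegOp.ext_single fun x y => ?_
    rw [LinearMap.comp_apply, conjOp_single, marginalOp_single, if_pos, he, he,
      LinearMap.id_apply]
    exact fun p hp => (he' x p hp).trans (he' y p hp).symm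

theorem marginalOp_surjective [Fintype P] [DecidableEq P] [Fintype P'] [DecidableEq P']
    (hq : 0 < q) (f : P' ↪ P) : Function.Surjective (marginalOp q f) := by
  obtain ⟨Φ, -, hΦ⟩ := exists_marginalOp_comp_eq_id hq f
  exact Function.RightInverse.surjective (LinearMap.congr_fun hΦ)

theorem finrank_regOp [Fintype P] [DecidableEq P] :
    Module.finrank ℂ (RegOp q P) = q ^ Fintype.card P * q ^ Fintype.card P := by
  rw [Module.finrank_matrix]
  simp

end Registers

theorem Function.Embedding.exists_trans_eq {A B P : Type*} {u : A ↪ P} {v : B ↪ P}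
    (h : Set.range u ⊆ Set.range v) : ∃ g : A ↪ B, g.trans v = u := by
  choose g hg using fun a => h ⟨a, rfl⟩
  refine ⟨⟨g, fun a b hab => u.injective ?_⟩, by ext a; exact hg a⟩
  rw [← hg a, ← hg b, hab]

namespace QSSScheme

variable {q : ℕ} {M : Type} [Fintype M] [DecidableEq M] {ι : Type} [Fintype ι] [DecidableEq ι]

/-! ### Authorized and unauthorized sets -/

/-- The qudits of the shares of the parties `f i`, among all qudits. -/
def sharesEmb {ι : Type} (Q : ι → Type) {κ : Type} (f : κ ↪ ι) : (Σ i, Q (f i)) ↪ Σ j, Q j where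
  toFun p := ⟨f p.1, p.2⟩
  inj' := by
    rintro ⟨i, x⟩ ⟨i', x'⟩ h
    obtain ⟨h1, h2⟩ := Sigma.mk.inj_iff.mp h
    obtain rfl := f.injective h1
    obtain rfl := eq_of_heq h2
    rfl

theorem range_sharesEmb {ι : Type} (Q : ι → Type) {κ : Type} (f : κ ↪ ι) :
    Set.range (sharesEmb Q f) = {p | p.1 ∈ Set.range f} := by
  ext ⟨j, x⟩
  constructor
  · rintro ⟨p, hp⟩
    exact ⟨p.1, congrArg Sigma.fst hp⟩
  · rintro ⟨i, rfl⟩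
    exact ⟨⟨i, x⟩, rfl⟩

theorem reduced_eq (S : QSSScheme q M ι) {κ : Type} (f : κ ↪ ι) :
    S.reduced f = marginalOp q (sharesEmb S.Q f) ∘ₗ S.enc := rfl

theorem isQuantumOp_reduced (S : QSSScheme q M ι) {κ : Type} [Fintype κ] [DecidableEq κ]
    (f : κ ↪ ι) : IsQuantumOp (S.reduced f) :=
  (isQuantumOp_marginalOp _).comp S.enc_isQuantumOp

/-- Fewer parties see a partial trace of what more parties see. Comparing ranges makes this
independent of how the parties are indexed. -/
theorem exists_reduced_eq (S : QSSScheme q M ι) {κ κ' : Type} [Fintype κ'] [DecidableEq κ']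
    {f : κ ↪ ι} {f' : κ' ↪ ι} (h : Set.range f ⊆ Set.range f') :
    ∃ g : (Σ i, S.Q (f i)) ↪ Σ i, S.Q (f' i), S.reduced f = marginalOp q g ∘ₗ S.reduced f' := by
  have h' : Set.range (sharesEmb S.Q f) ⊆ Set.range (sharesEmb S.Q f') := by
    rw [range_sharesEmb, range_sharesEmb]
    exact fun p hp => h hp
  obtain ⟨g, hg⟩ := Function.Embedding.exists_trans_eq h'
  refine ⟨g, ?_⟩
  rw [reduced_eq, reduced_eq, ← LinearMap.comp_assoc, marginalOp_comp, hg]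

/-- The linear form of recovery, valid on all operators, is what can be tensored with a spectator
register. -/
theorem recovers_iff (S : QSSScheme q M ι) {κ : Type} [Fintype κ] [DecidableEq κ] (f : κ ↪ ι)
    (dec : RegOp q (Σ i, S.Q (f i)) →ₗ[ℂ] RegOp q M) :
    S.Recovers f dec ↔ IsQuantumOp dec ∧ dec ∘ₗ S.reduced f = LinearMap.id :=
  and_congr_right fun _ => ⟨fun h => RegOp.ext_of_density h, fun h ρ _ => LinearMap.congr_fun h ρ⟩

theorem Authorized.exists_recovers {S : QSSScheme q M ι} {X : Finset ι} (hX : S.Authorized X)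
    {κ : Type} [Fintype κ] [DecidableEq κ] {f : κ ↪ ι} (h : ∀ j ∈ X, j ∈ Set.range f) :
    ∃ dec, S.Recovers f dec := by
  obtain ⟨dec, h1, h2⟩ := hX
  obtain ⟨g, hg⟩ := S.exists_reduced_eq (f := members X) (f' := f) (by
    rintro _ ⟨j, rfl⟩
    exact h j.1 j.2)
  refine ⟨dec ∘ₗ marginalOp q g, h1.comp (isQuantumOp_marginalOp g), fun ρ hρ => ?_⟩
  rw [LinearMap.comp_apply, ← LinearMap.comp_apply (marginalOp q g), ← hg]
  exact h2 ρ hρ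

/-- The linear extension from density operators restores the trace as a factor; this is the form
required by `idTensorOp_replace`. -/
theorem Unauthorized.exists_reduced {S : QSSScheme q M ι} {X : Finset ι} (hX : S.Unauthorized X)
    {κ : Type} {f : κ ↪ ι} (h : ∀ i, f i ∈ X) : ∃ τ, ∀ Y, S.reduced f Y = Y.trace • τ := by
  obtain ⟨τ, hτ⟩ := hX
  obtain ⟨g, hg⟩ := S.exists_reduced_eq (f := f) (f' := members X) (by
    rintro _ ⟨i, rfl⟩
    exact ⟨⟨f i, h i⟩, rfl⟩)
  refine ⟨marginalOp q g τ, fun Y => ?_⟩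
  have h2 : S.reduced f = (LinearMap.toSpanSingleton ℂ _ (marginalOp q g τ)) ∘ₗ
      Matrix.traceLinearMap (M → Fin q) ℂ ℂ := by
    refine RegOp.ext_of_density fun ρ hρ => ?_
    rw [hg, LinearMap.comp_apply, hτ ρ hρ]
    simp [hρ.2]
  exact LinearMap.congr_fun h2 Y

/-! ### Sizes of shares -/

/-- A recoverable secret makes the reduced map injective, so dimensions of operator spaces can be
compared; each register of `s` qudits contributes `q ^ (2 * s)`. -/
theorem card_le_of_recovers (hq : 2 ≤ q) {S : QSSScheme q M ι} {κ : Type} [Fintype κ]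
    [DecidableEq κ] {f : κ ↪ ι} {dec : RegOp q (Σ i, S.Q (f i)) →ₗ[ℂ] RegOp q M}
    (h : S.Recovers f dec) : Fintype.card M ≤ ∑ i, S.size (f i) := by
  have hinj : Function.Injective (S.reduced f) :=
    Function.LeftInverse.injective (g := dec) (LinearMap.congr_fun ((S.recovers_iff f dec).mp h).2)
  have h1 := LinearMap.finrank_le_finrank_of_injective hinj
  rw [finrank_regOp, finrank_regOp, ← pow_add, ← pow_add, Nat.pow_le_pow_iff_right hq,
    Fintype.card_sigma] at h1
  change _ + _ ≤ (∑ i, S.size (f i)) + ∑ i, S.size (f i) at h1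
  omega

/-- Equality would make the reduced map on `K` bijective, which is incompatible with the secrecy of
`K` minus one party unless the shares are empty. -/
theorem IsQTS.card_lt_sum_size (hq : 2 ≤ q) [Nonempty M] {S : QSSScheme q M ι} {k : ℕ}
    (hS : S.IsQTS k) {K : Finset ι} (hK : K.card = k) :
    Fintype.card M < ∑ j ∈ K, S.size j := by
  obtain ⟨⟨hk, -, -⟩, hA, hU⟩ := hS
  obtain ⟨dec, hdec⟩ := hA K hK.ge
  have hle := card_le_of_recovers hq hdec
  have hsum : ∑ i, S.size (members K i) = ∑ j ∈ K, S.size j := Finset.sum_coe_sort K S.size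
  rw [hsum] at hle
  refine lt_of_le_of_ne hle fun heq => ?_
  have hinj : Function.Injective (S.reduced (members K)) :=
    Function.LeftInverse.injective (g := dec)
      (LinearMap.congr_fun ((S.recovers_iff _ dec).mp hdec).2)
  have hsurj : Function.Surjective (S.reduced (members K)) := by
    refine (LinearMap.injective_iff_surjective_of_finrank_eq_finrank ?_).mp hinj
    have hc : Fintype.card (Σ i, S.Q (members K i)) = ∑ i, S.size (members K i) :=
      Fintype.card_sigma
    rw [finrank_regOp, finrank_regOp, hc, hsum, heq]
  -- The reduced map on `K.erase j` is still surjective, yet its range lies on the line spanned by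
  -- `τ`, so the remaining shares carry no qudits.
  have hzero : ∀ j ∈ K, ∀ i ∈ K, i ≠ j → S.size i = 0 := by
    intro j hj i hi hij
    have hlt : (K.erase j).card < k := by
      rw [← hK]
      exact Finset.card_erase_lt_of_mem hj
    obtain ⟨τ, hτ⟩ := (hU (K.erase j) hlt).exists_reduced (f := members (K.erase j)) fun i => i.2
    obtain ⟨g, hg⟩ := S.exists_reduced_eq (f := members (K.erase j)) (f' := members K) (by
      rintro _ ⟨i, rfl⟩
      exact ⟨⟨i.1, Finset.mem_of_mem_erase i.2⟩, rfl⟩)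
    have hs : Function.Surjective (S.reduced (members (K.erase j))) := by
      rw [hg, LinearMap.coe_comp]
      exact (marginalOp_surjective (by omega) g).comp hsurj
    have h1 : Module.finrank ℂ (RegOp q (Σ i, S.Q (members (K.erase j) i))) ≤ 1 :=
      finrank_le_one τ fun w => by
        obtain ⟨Y, rfl⟩ := hs w
        exact ⟨Y.trace, (hτ Y).symm⟩
    have hc : Fintype.card (Σ i, S.Q (members (K.erase j) i)) = ∑ i ∈ K.erase j, S.size i :=
      Fintype.card_sigma.trans (Finset.sum_coe_sort (K.erase j) S.size)
    rw [finrank_regOp, ← pow_add, hc, ← pow_zero q, Nat.pow_le_pow_iff_right hq] at h1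
    have h2 : S.size i ≤ ∑ i ∈ K.erase j, S.size i :=
      Finset.single_le_sum (f := S.size) (fun _ _ => Nat.zero_le _)
        (Finset.mem_erase.mpr ⟨hij, hi⟩)
    omega
  -- Since `1 < k`, every member of `K` survives the removal of some other member.
  have hall : ∑ j ∈ K, S.size j = 0 := by
    refine Finset.sum_eq_zero fun i hi => ?_
    obtain ⟨j, hj, hji⟩ := Finset.exists_mem_ne (by omega : 1 < K.card) i
    exact hzero j hj i hi hji.symm
  have := Fintype.card_pos (α := M)
  omega

end QSSScheme

namespace QSSScheme

variable {q : ℕ} {M : Type} [Fintype M] [DecidableEq M] {ι : Type} [Fintype ι] [DecidableEq ι]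
variable {ε ι' : Type} [Fintype ε] [DecidableEq ε] [Fintype ι'] [DecidableEq ι']

/-! ### Reduced states of the concatenation -/

theorem marginalOp_relabelOp_idTensorOp {ι κ L : Type} [Fintype ι] [DecidableEq ι] [Fintype κ]
    [DecidableEq κ] [Fintype L] [DecidableEq L] (α β : ι → Type) [∀ j, Fintype (α j)]
    [∀ j, DecidableEq (α j)] [∀ j, Fintype (β j)] [∀ j, DecidableEq (β j)] (f : κ ↪ ι)
    (Φ : RegOp q L →ₗ[ℂ] RegOp q (Σ j, β j)) (Z : RegOp q ((Σ j, α j) ⊕ L)) :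
    marginalOp q (sharesEmb (fun j => α j ⊕ β j) f)
      (relabelOp q (Equiv.sigmaSumDistrib α β).symm (idTensorOp (Σ j, α j) Φ Z)) =
    relabelOp q (Equiv.sigmaSumDistrib (fun i => α (f i)) fun i => β (f i)).symm
      (idTensorOp (Σ i, α (f i)) (marginalOp q (sharesEmb β f) ∘ₗ Φ)
        (marginalOp q ((sharesEmb α f).sumMap (Function.Embedding.refl L)) Z)) := by
  rw [← LinearMap.comp_apply (idTensorOp _ _), ← marginalOp_comp_idTensorOp, LinearMap.comp_apply,
    relabelOp_eq_marginalOp, relabelOp_eq_marginalOp, marginalOp_marginalOp, marginalOp_marginalOp]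
  congr 2
  ext ⟨j, x | x⟩ <;> rfl

/-- The qudits of the first layer of the members of `K` and of the extra shares, among the qudits
of all shares of `R`. -/
def extendedEmb (R : QSSScheme q M ι') (σ : ι ⊕ ε ≃ ι') (K : Finset ι) :
    (Σ j : {j // j ∈ K}, R.Q (σ (.inl (members K j)))) ⊕ (Σ l, R.Q (σ (.inr l))) ↪ Σ i, R.Q i :=
  ((sharesEmb (fun j => R.Q (σ (.inl j))) (members K)).sumMap (Function.Embedding.refl _)).trans
    (R.splitShares σ).symm.toEmbedding

/-- By locality, the members of `K` see the reduced map of `T` applied to the extra shares, next to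
their own ramp shares. Recovery and secrecy both start from this form. -/
theorem concat_reduced (R : QSSScheme q M ι') (σ : ι ⊕ ε ≃ ι')
    (T : QSSScheme q (Σ l, R.Q (σ (.inr l))) ι) (K : Finset ι) (ρ : RegOp q M) :
    (R.concat σ T).reduced (members K) ρ =
      relabelOp q (Equiv.sigmaSumDistrib (fun j => R.Q (σ (.inl (members K j))))
        fun j => T.Q (members K j)).symm
      (idTensorOp (Σ j, R.Q (σ (.inl (members K j)))) (T.reduced (members K))
        (marginalOp q (R.extendedEmb σ K) (R.enc ρ))) := by
  refine (marginalOp_relabelOp_idTensorOp (fun j => R.Q (σ (.inl j))) T.Q (members K) T.enc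
    (relabelOp q (R.splitShares σ) (R.enc ρ))).trans ?_
  rw [relabelOp_eq_marginalOp (R.splitShares σ), marginalOp_marginalOp]
  rfl

/-! ### Recovery and secrecy of the concatenation. -/

theorem relabelOp_symm_apply {P P' : Type} (e : P ≃ P') (Z : RegOp q P') :
    relabelOp q e (relabelOp q e.symm Z) = Z := by
  ext a b
  change Z (fun p => a (e (e.symm p))) (fun p => b (e (e.symm p))) = Z a b
  simp only [Equiv.apply_symm_apply]

theorem recovers_twoLayerDec (R : QSSScheme q M ι') (σ : ι ⊕ ε ≃ ι')
    (T : QSSScheme q (Σ l, R.Q (σ (.inr l))) ι) (K : Finset ι)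
    {decT : RegOp q (Σ j, T.Q (members K j)) →ₗ[ℂ] RegOp q (Σ l, R.Q (σ (.inr l)))}
    {decR : RegOp q (Σ x, R.Q (extendedParties σ K x)) →ₗ[ℂ] RegOp q M}
    (hT : T.Recovers (members K) decT) (hR : R.Recovers (extendedParties σ K) decR) :
    (R.concat σ T).Recovers (members K) (R.twoLayerDec σ T K decT decR) := by
  rw [recovers_iff] at hT hR
  refine ⟨?_, fun ρ hρ => ?_⟩
  · exact hR.1.comp ((isQuantumOp_relabelOp q _).comp
      ((isQuantumOp_idTensorOp _ hT.1).comp (isQuantumOp_relabelOp q _)))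
  · rw [concat_reduced]
    -- Decoding layer 2 undoes `T` even when the extra shares are entangled with layer 1.
    have h2 (Z : RegOp q ((Σ j, R.Q (σ (.inl (members K j)))) ⊕ Σ l, R.Q (σ (.inr l)))) :
        idTensorOp (Σ j, R.Q (σ (.inl (members K j)))) decT
          (idTensorOp (Σ j, R.Q (σ (.inl (members K j)))) (T.reduced (members K)) Z) = Z := by
      rw [← LinearMap.comp_apply, idTensorOp_comp, hT.2, idTensorOp_id, LinearMap.id_apply]
    -- Both sides are partial traces of `R.enc ρ` along the same embedding.
    have h3 : relabelOp q (Equiv.sumSigmaDistrib fun x => R.Q (extendedParties σ K x)).symm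
        (marginalOp q (R.extendedEmb σ K) (R.enc ρ)) = R.reduced (extendedParties σ K) ρ := by
      rw [relabelOp_eq_marginalOp]
      refine (marginalOp_marginalOp (R.extendedEmb σ K) _ (R.enc ρ)).trans
        (congrArg (fun u => marginalOp q u (R.enc ρ)) ?_)
      ext ⟨j | l, x⟩ <;> rfl
    refine Eq.trans (congrArg decR ?_) (LinearMap.congr_fun hR.2 ρ)
    refine Eq.trans (congrArg (relabelOp q (Equiv.sumSigmaDistrib fun x =>
      R.Q (extendedParties σ K x)).symm) ?_) h3
    refine Eq.trans (congrArg (idTensorOp (Σ j, R.Q (σ (.inl (members K j)))) decT) ?_) (h2 _)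
    exact relabelOp_symm_apply (Equiv.sigmaSumDistrib (fun j => R.Q (σ (.inl (members K j))))
      fun j => T.Q (members K j)) _

theorem marginalOp_inl_extendedEmb {ι : Type} [DecidableEq ι] (R : QSSScheme q M ι') (σ : ι ⊕ ε ≃ ι') (K : Finset ι)
    (ρ : RegOp q M) :
    marginalOp q Function.Embedding.inl (marginalOp q (R.extendedEmb σ K) (R.enc ρ)) =
      R.reduced (layerOneParties σ K) ρ := by
  rw [marginalOp_marginalOp]
  rfl

theorem localOp_marginalOp_inl {κ : Type} [Fintype κ] [DecidableEq κ] {α β : κ → Type}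
    [∀ j, Fintype (α j)] [∀ j, DecidableEq (α j)] [∀ j, Fintype (β j)] [∀ j, DecidableEq (β j)]
    (Z : RegOp q ((Σ j, α j) ⊕ Σ j, β j)) :
    localOp (fun j => marginalOp q (Function.Embedding.inl : α j ↪ α j ⊕ β j))
      (relabelOp q (Equiv.sigmaSumDistrib α β).symm Z) =
      marginalOp q Function.Embedding.inl Z := by
  rw [localOp_marginalOp, relabelOp_eq_marginalOp, marginalOp_marginalOp]
  rfl

theorem recoversFromParts_layerOne (R : QSSScheme q M ι') (σ : ι ⊕ ε ≃ ι')
    (T : QSSScheme q (Σ l, R.Q (σ (.inr l))) ι) (D : Finset ι)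
    {decR : RegOp q (Σ x, R.Q (layerOneParties σ D x)) →ₗ[ℂ] RegOp q M}
    (hR : R.Recovers (layerOneParties σ D) decR) :
    (R.concat σ T).RecoversFromParts (members D) (R.layerOne σ T D) decR := by
  refine ⟨fun j => isQuantumOp_marginalOp (P := R.Q (σ (.inl j.1)) ⊕ T.Q j.1) _, hR.1,
    fun ρ hρ => ?_⟩
  refine Eq.trans (congrArg decR ?_) (hR.2 ρ hρ)
  rw [← marginalOp_inl_extendedEmb, concat_reduced, ← marginalOp_inl_idTensorOp
    (T.isQuantumOp_reduced (members D))]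
  exact localOp_marginalOp_inl (α := fun j => R.Q (σ (.inl (members D j))))
    (β := fun j => T.Q (members D j)) _

/-- Layer 2 is a replacement by `τ`, so the joint state is a product of `τ` with the layer 1 state,
which is fixed by the secrecy of `R`. -/
theorem concat_unauthorized {R : QSSScheme q M ι'} {σ : ι ⊕ ε ≃ ι'}
    {T : QSSScheme q (Σ l, R.Q (σ (.inr l))) ι} {X : Finset ι} (hT : T.Unauthorized X)
    (hR : R.Unauthorized (X.map (Function.Embedding.inl.trans σ.toEmbedding))) :
    (R.concat σ T).Unauthorized X := by
  obtain ⟨τ, hτ⟩ := hT.exists_reduced (f := members X) fun i => i.2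
  obtain ⟨τ', hτ'⟩ := hR.exists_reduced (f := layerOneParties σ X) fun i =>
    Finset.mem_map_of_mem _ i.2
  refine ⟨relabelOp q (Equiv.sigmaSumDistrib (fun j => R.Q (σ (.inl (members X j))))
        fun j => T.Q (members X j)).symm (tensOp τ' τ), fun ρ hρ => ?_⟩
  refine (concat_reduced R σ T X ρ).trans (congrArg (relabelOp q (Equiv.sigmaSumDistrib
    (fun j => R.Q (σ (.inl (members X j)))) fun j => T.Q (members X j)).symm) ?_)
  rw [idTensorOp_replace hτ, marginalOp_inl_extendedEmb, hτ', hρ.2, one_smul]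
  rfl

/-! ### Threshold property and download cost of the concatenation. -/

theorem IsRamp.exists_recovers_layerOneParties {ι ε : Type} [DecidableEq ι] {R : QSSScheme q M ι'} {d z : ℕ}
    (hR : R.IsRamp d z) (σ : ι ⊕ ε ≃ ι') {D : Finset ι} (hD : D.card = d) :
    ∃ dec, R.Recovers (layerOneParties σ D) dec := by
  refine (hR.2.1 (D.map (Function.Embedding.inl.trans σ.toEmbedding)) ?_).exists_recovers ?_
  · rw [Finset.card_map, hD]
  · intro j hj
    obtain ⟨i, hi, rfl⟩ := Finset.mem_map.mp hj
    exact ⟨⟨i, hi⟩, rfl⟩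

theorem IsRamp.exists_recovers_extendedParties {ι : Type} [DecidableEq ι] {R : QSSScheme q M ι'} {d z : ℕ}
    (hR : R.IsRamp d z) (σ : ι ⊕ ε ≃ ι') {K : Finset ι} (hK : d ≤ K.card + Fintype.card ε) :
    ∃ dec, R.Recovers (extendedParties σ K) dec := by
  refine (hR.2.1 (Finset.univ.map (extendedParties σ K)) ?_).exists_recovers ?_
  · rw [Finset.card_map, Finset.card_univ, Fintype.card_sum, Fintype.card_coe]
    exact hK
  · intro j hj
    obtain ⟨i, -, rfl⟩ := Finset.mem_map.mp hj
    exact ⟨i, rfl⟩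

theorem concat_isQTS {R : QSSScheme q M ι'} {σ : ι ⊕ ε ≃ ι'}
    {T : QSSScheme q (Σ l, R.Q (σ (.inr l))) ι} {k d : ℕ} (hR : R.IsRamp d (k - 1))
    (hd : d ≤ k + Fintype.card ε) (hT : T.IsQTS k) : (R.concat σ T).IsQTS k := by
  obtain ⟨hk, hA, hU⟩ := hT
  refine ⟨hk, fun X hX => ?_, fun X hX => ?_⟩
  · obtain ⟨decT, hdecT⟩ := hA X hX
    obtain ⟨decR, hdecR⟩ := hR.exists_recovers_extendedParties σ (K := X) (by omega)
    exact ⟨_, recovers_twoLayerDec R σ T X hdecT hdecR⟩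
  · refine concat_unauthorized (hU X hX) (hR.2.2 _ ?_)
    rw [Finset.card_map]
    omega

theorem maxCost_layerOne_lt_thresholdCost (hq : 2 ≤ q) [Nonempty M] {R : QSSScheme q M ι'}
    {σ : ι ⊕ ε ≃ ι'} (hσ : R.ExtraLargest σ) {T : QSSScheme q (Σ l, R.Q (σ (.inr l))) ι}
    {k d : ℕ} (hR : R.IsRamp d (k - 1)) (hd : d = k + Fintype.card ε) (hε : 0 < Fintype.card ε)
    (hdn : d ≤ Fintype.card ι) (hT : T.IsQTS k) :
    maxCost d (fun D : {D : Finset ι // D.card = d} => ∑ j ∈ D.1, R.size (σ (.inl j))) <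
      (R.concat σ T).thresholdCost k := by
  have hcard : Fintype.card (Σ l, R.Q (σ (.inr l))) = ∑ l, R.size (σ (.inr l)) :=
    Fintype.card_sigma
  have key (D : Finset ι) (hD : D.card = d) :
      ∑ j ∈ D, R.size (σ (.inl j)) < (R.concat σ T).thresholdCost k := by
    obtain ⟨K, hKD, hK⟩ := Finset.exists_subset_card_eq (by omega : k ≤ D.card)
    have hle : ∑ j ∈ K, (R.concat σ T).size j ≤ (R.concat σ T).thresholdCost k :=
      Finset.le_sup (f := fun X : {X : Finset ι // X.card = k} =>
        ∑ j ∈ X.1, (R.concat σ T).size j) (Finset.mem_univ ⟨K, hK⟩)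
    have hsize (j : ι) : (R.concat σ T).size j = R.size (σ (.inl j)) + T.size j :=
      Fintype.card_sum
    simp only [hsize, Finset.sum_add_distrib] at hle
    have hsplit : ∑ j ∈ D \ K, R.size (σ (.inl j)) + ∑ j ∈ K, R.size (σ (.inl j)) =
        ∑ j ∈ D, R.size (σ (.inl j)) := Finset.sum_sdiff hKD
    -- There are as many parties in `D \ K` as extra shares; any bijection gives a termwise bound
    -- because the extra shares are largest.
    have hrest : ∑ j ∈ D \ K, R.size (σ (.inl j)) ≤ ∑ l, R.size (σ (.inr l)) := by
      have hc : Fintype.card {j // j ∈ D \ K} = Fintype.card ε := by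
        rw [Fintype.card_coe, Finset.card_sdiff_of_subset hKD]
        omega
      rw [← Finset.sum_coe_sort, ← (Fintype.equivOfCardEq hc).sum_comp]
      exact Finset.sum_le_sum fun j _ => hσ _ _
    -- Strictness needs a nonempty secret of `T`. If the extra shares were empty, so would be all
    -- ramp shares, yet `d` of them recover a nonempty secret.
    have hpos : Nonempty (Σ l, R.Q (σ (.inr l))) := by
      by_contra hne
      have h0 : ∑ l, R.size (σ (.inr l)) = 0 := by
        rw [← hcard, Fintype.card_eq_zero_iff]
        exact not_nonempty_iff.mp hne
      obtain ⟨l⟩ := Fintype.card_pos_iff.mp hε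
      have hl : R.size (σ (.inr l)) = 0 :=
        (Finset.sum_eq_zero_iff.mp h0) l (Finset.mem_univ l)
      obtain ⟨dec, hdec⟩ := hR.exists_recovers_layerOneParties σ hD
      have h1 := card_le_of_recovers hq hdec
      have h2 : ∑ i, R.size (layerOneParties σ D i) = 0 :=
        Finset.sum_eq_zero fun i _ => Nat.le_zero.mp (hl ▸ hσ i.1 l)
      have := Fintype.card_pos (α := M)
      omega
    have := hT.card_lt_sum_size hq hK
    omega
  -- A strict bound on a supremum in `ℕ` also needs a positive bound; one set of `d` parties,
  -- available since `d ≤ n`, supplies it.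
  obtain ⟨D, -, hD⟩ := Finset.exists_subset_card_eq (s := (Finset.univ : Finset ι))
    (n := d) (by rwa [Finset.card_univ])
  exact (Finset.sup_lt_iff (lt_of_le_of_lt (Nat.zero_le _) (key D hD))).mpr fun D _ => key D.1 D.2

theorem concat_isCEQTS (hq : 2 ≤ q) [Nonempty M] {R : QSSScheme q M ι'}
    {σ : ι ⊕ ε ≃ ι'} (hσ : R.ExtraLargest σ) {T : QSSScheme q (Σ l, R.Q (σ (.inr l))) ι}
    {k d : ℕ} (hR : R.IsRamp d (k - 1)) (hd : d = k + Fintype.card ε) (hε : 0 < Fintype.card ε)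
    (hdn : d ≤ Fintype.card ι) (hT : T.IsQTS k) : (R.concat σ T).IsCEQTS k d := by
  refine ⟨concat_isQTS hR hd.le hT, by omega, hdn, ?_⟩
  choose dec hdec using fun D : {D : Finset ι // D.card = d} =>
    hR.exists_recovers_layerOneParties σ D.2
  refine ⟨fun D => ⟨fun j => R.Q (layerOneParties σ D.1 j), fun _ => inferInstance,
    fun _ => inferInstance, R.layerOne σ T D.1, dec D,
    recoversFromParts_layerOne R σ T D.1 (hdec D)⟩, ?_⟩
  have h (D : {D : Finset ι // D.card = d}) :
      ∑ j, Fintype.card (R.Q (layerOneParties σ D.1 j)) = ∑ j ∈ D.1, R.size (σ (.inl j)) :=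
    Finset.sum_coe_sort D.1 fun j => R.size (σ (.inl j))
  simp only [Download.cost, h]
  exact maxCost_layerOne_lt_thresholdCost hq hσ hR hd hε hdn hT

end QSSScheme

/-! ### Tensor products of operations -/

section Registers

variable {q : ℕ} {A A' A'' B B' B'' : Type}

/-- The tensor product of two linear maps between operators. -/
def prodOp (Φ : RegOp q A →ₗ[ℂ] RegOp q A') (Ψ : RegOp q B →ₗ[ℂ] RegOp q B') :
    RegOp q (A ⊕ B) →ₗ[ℂ] RegOp q (A' ⊕ B') :=
  idTensorOp A' Ψ ∘ₗ relabelOp q (Equiv.sumComm B A') ∘ₗ idTensorOp B Φ ∘ₗ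
    relabelOp q (Equiv.sumComm A B)

theorem relabelOp_sumComm_tens (X : RegOp q A) (Y : RegOp q B) :
    relabelOp q (Equiv.sumComm A B) (tensOp X Y) = tensOp Y X := by
  ext a b
  exact mul_comm _ _

theorem prodOp_tens (Φ : RegOp q A →ₗ[ℂ] RegOp q A') (Ψ : RegOp q B →ₗ[ℂ] RegOp q B')
    (X : RegOp q A) (Y : RegOp q B) : prodOp Φ Ψ (tensOp X Y) = tensOp (Φ X) (Ψ Y) := by
  simp only [prodOp, LinearMap.comp_apply, relabelOp_sumComm_tens, idTensorOp_tens]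

theorem IsQuantumOp.prodOp [Fintype A] [DecidableEq A] [Fintype B] [DecidableEq B] [Fintype A']
    [DecidableEq A'] [Fintype B'] [DecidableEq B'] {Φ : RegOp q A →ₗ[ℂ] RegOp q A'}
    {Ψ : RegOp q B →ₗ[ℂ] RegOp q B'} (hΦ : IsQuantumOp Φ) (hΨ : IsQuantumOp Ψ) :
    IsQuantumOp (prodOp Φ Ψ) :=
  (isQuantumOp_idTensorOp _ hΨ).comp ((isQuantumOp_relabelOp q _).comp
    ((isQuantumOp_idTensorOp _ hΦ).comp (isQuantumOp_relabelOp q _)))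

theorem prodOp_comp_eq_id [Finite A] [Finite B] {Φ : RegOp q A →ₗ[ℂ] RegOp q A'}
    {Ψ : RegOp q B →ₗ[ℂ] RegOp q B'} {Φ' : RegOp q A' →ₗ[ℂ] RegOp q A}
    {Ψ' : RegOp q B' →ₗ[ℂ] RegOp q B} (hΦ : Φ' ∘ₗ Φ = LinearMap.id)
    (hΨ : Ψ' ∘ₗ Ψ = LinearMap.id) : prodOp Φ' Ψ' ∘ₗ prodOp Φ Ψ = LinearMap.id :=
  RegOp.ext_tens fun X Y => by
    rw [LinearMap.comp_apply, prodOp_tens, prodOp_tens, ← LinearMap.comp_apply Φ',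
      ← LinearMap.comp_apply Ψ', hΦ, hΨ, LinearMap.id_apply, LinearMap.id_apply,
      LinearMap.id_apply]

theorem trace_tensOp [Fintype A] [Fintype B] [DecidableEq A] [DecidableEq B] (X : RegOp q A)
    (Y : RegOp q B) : (tensOp X Y).trace = X.trace * Y.trace := by
  rw [← (isQuantumOp_marginalOp (Function.Embedding.inl : A ↪ A ⊕ B)).trace_apply,
    marginalOp_inl_tens, Matrix.trace_smul, smul_eq_mul, mul_comm]

/-- Product operators span, so independent sharing hides even a secret entangled across the two
registers. -/
theorem prodOp_replace [Fintype A] [Fintype B] [DecidableEq A] [DecidableEq B]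
    {Φ : RegOp q A →ₗ[ℂ] RegOp q A'} {Ψ : RegOp q B →ₗ[ℂ] RegOp q B'} {τ : RegOp q A'}
    {τ' : RegOp q B'} (hΦ : ∀ X, Φ X = X.trace • τ) (hΨ : ∀ Y, Ψ Y = Y.trace • τ')
    (Z : RegOp q (A ⊕ B)) : prodOp Φ Ψ Z = Z.trace • tensOp τ τ' := by
  have h : prodOp Φ Ψ = LinearMap.toSpanSingleton ℂ _ (tensOp τ τ') ∘ₗ
      Matrix.traceLinearMap (A ⊕ B → Fin q) ℂ ℂ :=
    RegOp.ext_tens fun X Y => by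
      rw [prodOp_tens, hΦ, hΨ, LinearMap.comp_apply, Matrix.traceLinearMap_apply, trace_tensOp,
        LinearMap.toSpanSingleton_apply, map_smul, map_smul, LinearMap.smul_apply, smul_smul,
        mul_comm]
  exact LinearMap.congr_fun h Z

theorem marginalOp_relabelOp_prodOp {ι κ : Type} [Fintype ι] [DecidableEq ι] [Fintype κ]
    [DecidableEq κ] [Fintype A] [DecidableEq A] [Fintype B] [DecidableEq B] (α β : ι → Type)
    [∀ j, Fintype (α j)] [∀ j, DecidableEq (α j)] [∀ j, Fintype (β j)] [∀ j, DecidableEq (β j)]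
    (f : κ ↪ ι) (Φ : RegOp q A →ₗ[ℂ] RegOp q (Σ j, α j)) (Ψ : RegOp q B →ₗ[ℂ] RegOp q (Σ j, β j)) :
    marginalOp q (QSSScheme.sharesEmb (fun j => α j ⊕ β j) f) ∘ₗ
      relabelOp q (Equiv.sigmaSumDistrib α β).symm ∘ₗ prodOp Φ Ψ =
    relabelOp q (Equiv.sigmaSumDistrib (fun i => α (f i)) fun i => β (f i)).symm ∘ₗ
      prodOp (marginalOp q (QSSScheme.sharesEmb α f) ∘ₗ Φ)
        (marginalOp q (QSSScheme.sharesEmb β f) ∘ₗ Ψ) := by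
  have h : prodOp (marginalOp q (QSSScheme.sharesEmb α f) ∘ₗ Φ)
        (marginalOp q (QSSScheme.sharesEmb β f) ∘ₗ Ψ) =
      marginalOp q ((QSSScheme.sharesEmb α f).sumMap (QSSScheme.sharesEmb β f)) ∘ₗ
        prodOp Φ Ψ :=
    RegOp.ext_tens fun X Y => by
      simp only [prodOp_tens, LinearMap.comp_apply, marginalOp_tens]
  rw [h, relabelOp_eq_marginalOp, relabelOp_eq_marginalOp, ← LinearMap.comp_assoc,
    ← LinearMap.comp_assoc, marginalOp_comp, marginalOp_comp]
  congr 2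
  ext ⟨j, x | x⟩ <;> rfl

end Registers

namespace QSSScheme

variable {q : ℕ} {M : Type} [Fintype M] [DecidableEq M] {ι : Type} [Fintype ι] [DecidableEq ι]
variable {M' : Type} [Fintype M'] [DecidableEq M']

/-! ### Threshold schemes for secrets of any size -/

/-- A threshold scheme also encodes smaller secrets. -/
theorem IsQTS.exists_of_embedding (hq : 0 < q) {S : QSSScheme q M ι} {k : ℕ} (hS : S.IsQTS k)
    (f : M' ↪ M) : ∃ T : QSSScheme q M' ι, T.IsQTS k := by
  obtain ⟨hk, hA, hU⟩ := hS
  -- The smaller secret is padded by `Φ` before encoding, and the padding is traced out after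
  -- decoding.
  obtain ⟨Φ, hΦ, hfΦ⟩ := exists_marginalOp_comp_eq_id hq f
  refine ⟨⟨S.Q, S.fintypeQ, S.decEqQ, S.enc ∘ₗ Φ, S.enc_isQuantumOp.comp hΦ⟩, hk,
    fun X hX => ?_, fun X hX => ?_⟩
  · obtain ⟨dec, hdec, hdec'⟩ := hA X hX
    refine ⟨marginalOp q f ∘ₗ dec, (isQuantumOp_marginalOp f).comp hdec, fun ρ hρ => ?_⟩
    exact (congrArg (marginalOp q f) (hdec' _ (hΦ.isDensityOp hρ))).trans
      (LinearMap.congr_fun hfΦ ρ)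
  · obtain ⟨τ, hτ⟩ := hU X hX
    exact ⟨τ, fun ρ hρ => hτ _ (hΦ.isDensityOp hρ)⟩

/-- Sharing two secrets independently. -/
def prod (S : QSSScheme q M ι) (T : QSSScheme q M' ι) : QSSScheme q (M ⊕ M') ι where
  Q j := S.Q j ⊕ T.Q j
  fintypeQ _ := inferInstance
  decEqQ _ := inferInstance
  enc := relabelOp q (Equiv.sigmaSumDistrib S.Q T.Q).symm ∘ₗ prodOp S.enc T.enc
  enc_isQuantumOp := (isQuantumOp_relabelOp q _).comp
    (S.enc_isQuantumOp.prodOp T.enc_isQuantumOp)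

theorem prod_reduced (S : QSSScheme q M ι) (T : QSSScheme q M' ι) (X : Finset ι)
    (ρ : RegOp q (M ⊕ M')) :
    (S.prod T).reduced (members X) ρ =
      relabelOp q (Equiv.sigmaSumDistrib (fun j => S.Q (members X j))
        fun j => T.Q (members X j)).symm
      (prodOp (S.reduced (members X)) (T.reduced (members X)) ρ) :=
  LinearMap.congr_fun (marginalOp_relabelOp_prodOp S.Q T.Q (members X) S.enc T.enc) ρ

theorem IsQTS.prod {S : QSSScheme q M ι} {T : QSSScheme q M' ι} {k : ℕ} (hS : S.IsQTS k)
    (hT : T.IsQTS k) : (S.prod T).IsQTS k := by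
  refine ⟨hS.1, fun X hX => ?_, fun X hX => ?_⟩
  · obtain ⟨decS, hdecS⟩ := hS.2.1 X hX
    obtain ⟨decT, hdecT⟩ := hT.2.1 X hX
    rw [recovers_iff] at hdecS hdecT
    refine ⟨prodOp decS decT ∘ₗ relabelOp q (Equiv.sigmaSumDistrib
      (fun j => S.Q (members X j)) fun j => T.Q (members X j)),
      (hdecS.1.prodOp hdecT.1).comp (isQuantumOp_relabelOp q _), fun ρ hρ => ?_⟩
    rw [prod_reduced]
    refine Eq.trans (congrArg (prodOp decS decT) ?_)
      (LinearMap.congr_fun (prodOp_comp_eq_id hdecS.2 hdecT.2) ρ)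
    exact relabelOp_symm_apply (Equiv.sigmaSumDistrib (fun j => S.Q (members X j))
      fun j => T.Q (members X j)) _
  · obtain ⟨τ, hτ⟩ := (hS.2.2 X hX).exists_reduced (f := members X) fun i => i.2
    obtain ⟨τ', hτ'⟩ := (hT.2.2 X hX).exists_reduced (f := members X) fun i => i.2
    refine ⟨relabelOp q (Equiv.sigmaSumDistrib (fun j => S.Q (members X j))
      fun j => T.Q (members X j)).symm (tensOp τ τ'), fun ρ hρ => ?_⟩
    refine (prod_reduced S T X ρ).trans (congrArg (relabelOp q (Equiv.sigmaSumDistrib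
      (fun j => S.Q (members X j)) fun j => T.Q (members X j)).symm) ?_)
    rw [prodOp_replace hτ hτ', hρ.2, one_smul]

/-- By induction on the secret size: pairing with one more copy of `S` adds at least one qudit, and
any surplus is removed by padding. -/
theorem IsQTS.exists_scheme (hq : 0 < q) [Nonempty M] {S : QSSScheme q M ι} {k : ℕ}
    (hS : S.IsQTS k) : ∃ T : QSSScheme q M' ι, T.IsQTS k := by
  have h (N : ℕ) : ∃ T : QSSScheme q (Fin N) ι, T.IsQTS k := by
    induction N with
    | zero => exact hS.exists_of_embedding hq (Function.Embedding.ofIsEmpty)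
    | succ N ih =>
      obtain ⟨T, hT⟩ := ih
      have : Nonempty (Fin (N + 1) ↪ Fin N ⊕ M) := by
        refine Function.Embedding.nonempty_of_card_le ?_
        have := Fintype.card_pos (α := M)
        rw [Fintype.card_sum, Fintype.card_fin, Fintype.card_fin]
        omega
      exact (hT.prod hS).exists_of_embedding hq this.some
  obtain ⟨T, hT⟩ := h (Fintype.card M')
  exact hT.exists_of_embedding hq (Fintype.equivFin M').toEmbedding

theorem exists_extraLargest {a b c : ℕ} (h : a + b = c) (R : QSSScheme q M (Fin c)) :
    ∃ σ : Fin a ⊕ Fin b ≃ Fin c, R.ExtraLargest σ := by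
  subst h
  refine ⟨finSumFinEquiv.trans (Tuple.sort R.size), fun j l => ?_⟩
  -- After sorting, the first `a` positions precede the last `b`, so the latter carry the largest
  -- shares.
  refine Tuple.monotone_sort R.size ?_
  rw [finSumFinEquiv_apply_left, finSumFinEquiv_apply_right, Fin.le_def, Fin.val_castAdd,
    Fin.val_natAdd]
  omega

end QSSScheme

/-! ### The concatenation framework for fixed `d`. -/

theorem mainTheorem6 (q k n d m : ℕ) (hq : 2 ≤ q) (hkd : k < d) (hdn : d ≤ n) (hm : 0 < m)
    (R : QSSScheme q (Fin m) (Fin (n + d - k))) (hR : R.IsRamp d (k - 1)) :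
    -- the concatenation of `R` with a threshold scheme for the extra shares
    (∀ (σ : Fin n ⊕ Fin (d - k) ≃ Fin (n + d - k)), R.ExtraLargest σ →
      ∀ T : QSSScheme q (Σ l, R.Q (σ (.inr l))) (Fin n), T.IsQTS k →
        (R.concat σ T).IsCEQTS k d ∧
        -- recovery from the full shares of any `k` parties
        (∀ K : Finset (Fin n), K.card = k → ∀ decT decR,
          T.Recovers (QSSScheme.members K) decT →
          R.Recovers (QSSScheme.extendedParties σ K) decR →
          (R.concat σ T).Recovers (QSSScheme.members K) (R.twoLayerDec σ T K decT decR)) ∧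
        -- recovery from layer 1 of any `d` parties
        (∀ D : Finset (Fin n), D.card = d → ∀ decR,
          R.Recovers (QSSScheme.layerOneParties σ D) decR →
          (R.concat σ T).RecoversFromParts (QSSScheme.members D) (R.layerOne σ T D) decR) ∧
        -- `CC_n(d) < CC_n(k)` for these two recoveries
        QSSScheme.maxCost d
            (fun D : {D : Finset (Fin n) // D.card = d} => ∑ j ∈ D.1, R.size (σ (.inl j))) <
          (R.concat σ T).thresholdCost k) ∧
    -- existence, from any threshold scheme over qudits of the same dimension
    ((∃ (m' : ℕ) (T₀ : QSSScheme q (Fin m') (Fin n)), 0 < m' ∧ T₀.IsQTS k) →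
      ∃ (σ : Fin n ⊕ Fin (d - k) ≃ Fin (n + d - k))
        (T : QSSScheme q (Σ l, R.Q (σ (.inr l))) (Fin n)),
        R.ExtraLargest σ ∧ T.IsQTS k ∧ (R.concat σ T).IsCEQTS k d) := by
  have : Nonempty (Fin m) := ⟨⟨0, hm⟩⟩
  have hd : d = k + Fintype.card (Fin (d - k)) := by
    rw [Fintype.card_fin]
    omega
  have hε : 0 < Fintype.card (Fin (d - k)) := by
    rw [Fintype.card_fin]
    omega
  have hdn' : d ≤ Fintype.card (Fin n) := by rwa [Fintype.card_fin]
  refine ⟨fun σ hσ T hT => ⟨QSSScheme.concat_isCEQTS hq hσ hR hd hε hdn' hT,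
    fun K _ decT decR h1 h2 => QSSScheme.recovers_twoLayerDec R σ T K h1 h2,
    fun D _ decR h => QSSScheme.recoversFromParts_layerOne R σ T D h,
    QSSScheme.maxCost_layerOne_lt_thresholdCost hq hσ hR hd hε hdn' hT⟩, ?_⟩
  rintro ⟨m', T₀, hm', hT₀⟩
  have : Nonempty (Fin m') := ⟨⟨0, hm'⟩⟩
  obtain ⟨σ, hσ⟩ := QSSScheme.exists_extraLargest (by omega : n + (d - k) = n + d - k) R
  -- The secret size of `T` is dictated by the extra shares, whatever `m'` is.
  obtain ⟨T, hT⟩ := hT₀.exists_scheme (M' := Σ l, R.Q (σ (.inr l))) (by omega)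
  exact ⟨σ, T, hσ, hT, QSSScheme.concat_isCEQTS hq hσ hR hd hε hdn' hT⟩
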